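/- **The problem.** A walker has to make a complete circuit on a circular road of length 5 units, starting and ending at a base $O$ on the road, walking 1 unit per day without ever resting. The base has an unlimited stock of sealed boxes, each with the ration of one day. He can carry rations for at most two days, and can walk only while eating from an unsealed box; so while walking he has one unsealed box, containing at most one ration, and at most one sealed box. A sealed box may be put down anywhere on the road and picked up again later. A box can be unsealed at any time; an unsealed box cannot be dumped for later use, and unsealing a new box replaces the old one, whose remaining contents are thrown away. The circuit is completed when the walker is at the base and every point of the road has been visited, and the expedition then ends. (Both walking around and, say, a round trip on either side count; this only strengthens the lower bounds below.) The time is the number of days walked. Two conventions are considered: (i) *discarding*: an unsealed box stays good until it is used up or thrown away; (ii) *ants*: whatever is left in an unsealed box at nightfall (at the end of a calendar day) is lost, but the walk may start at any moment of the day. **Cole's measure.** Each box is labelled with the direction in which it was (last) taken away from the base. If the final trip from the base goes around, then part C of the expedition begins when, for the first time on that trip, a box is unsealed that was taken away from the base in the direction opposite to that trip. The expedition is charged the time before part C plus the number of boxes unsealed in part C. If there is no part C, it is charged its total time. **Algorithm.** Let the position be the distance from the base in miles, in a fixed direction, 20 miles being one unit (so that position $100$ is the base again). 1. Dump one box at $98\frac34$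 and return to base. 2. Dump one at $97\frac12$, return to $98\frac34$, pick up one, dump it at $91\frac14$ and return to base. 3. Dump one at $93\frac34$, return to $97\frac12$, pick up one, dump it at $93\frac34$ and return to base. 4. Dump two at $90$ and return to base. 5. Dump one at $86\frac78$ and return to $93\frac34$. 6. Dump one at $82\frac12$, return to $86\frac78$, pick up one, dump it at $86\frac14$ and return to $90$. 7. Dump one at $80$, return to $86\frac14$, pick up one and get to $82\frac12$. 8. Dump one at $71\frac14$ and return to $80$. 9. Return to base. 10. Dump five at $10$ and return to base. 11. Dump one at $12\frac12$, return to $10$, pick up one, dump it at $12\frac12$ and return to $10$. 12. Dump one at $20$ and return to $10$. 13. Dump one at $20\frac58$, return to $20$, pick up one, dump it at $20\frac58$ and return to $12\frac12$. 14. Dump one at $26\frac9{16}$ and return to $20\frac58$. 15. Dump one at $31\frac14$, return to $26\frac9{16}$, pick up one and get to $31\frac14$. 16. March to $71\frac14$. 17. March to base, unsealing the boxes left at $71\frac14$ and $91\frac14$. Steps 1–9 and 17 are on the last stretch of the road, steps 10–16 lead around from the other side. **Theorem.** Under each of the conventions (i) and (ii), the algorithm (started $\frac78$ of the way through a day) can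 be carried out and completes the circuit, going around the road. It takes $22\frac9{16}$ days, and this is the minimum time over all expeditions (and all starting moments) that complete the circuit. In Cole's measure it is charged $23\frac18$ days, and this is the minimum of Cole's measure over all expeditions (and all starting moments) that complete the circuit. -/

import Mathlib

/-- What may happen to a partly used (unsealed) box.
`discard`: it stays good until it is used up or thrown away.
`ants`: whatever is left in it at nightfall is lost; in exchange the walk may start at any
moment of the day. -/
inductive Convention
  | discard
  | ants

/-- The part of a freshly unsealed one-day box that can be eaten, when it is unsealed at clock
time `c`. Time is measured in days, and the dawns are the integers. -/
noncomputable def Convention.portion : Convention → ℝ → ℝ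
  | .discard, _ => 1
  | .ants, c => 1 - Int.fract c

/-- Elementary actions. `walk y` is a straight walk to the point with coordinate `y`. `take o`
picks up a sealed box (of origin `o`, see `ExpeditionState`), `drop` puts down the sealed box in
hand, `unpack` unseals the sealed box in hand. -/
inductive ExpeditionAction
  | walk (y : ℝ)
  | take (o : SignType)
  | drop
  | unpack

/-- The state of an expedition around a circuit of length `5`; the base is the point `0` of the
circle `AddCircle 5`, and has an unlimited stock of sealed one-day boxes. Unit of length: one
day's walk.

* `pos`: the walker's coordinate, i.e. the signed distance covered since he was last at the base;
  it lies in `[-5, 5]`, and its sign is the direction in which he left the base.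
* `opened`: what is left in the unsealed box that he is eating from. While walking he always has
  such a box, so that of the two boxes he can carry only one is sealed.
* `hand`: the sealed box in hand, if any.
* `ground`: the sealed boxes put down outside the base, with their places.
* `visited`: the points of the circuit that have been visited.
* `time`: the time walked so far (he never rests).
* `partC`: see `ExpeditionState.cole`.

Every sealed box carries its origin: the direction (sign) in which it was taken away from the
base. -/
structure ExpeditionState where
  pos : ℝ
  opened : ℝ
  hand : Option SignType
  ground : Multiset (SignType × AddCircle (5 : ℝ))
  visited : Set (AddCircle (5 : ℝ))
  time : ℝ
  partC : Option (ℝ × ℕ)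

/-- At the base, with nothing yet done. -/
def ExpeditionState.initial : ExpeditionState where
  pos := 0
  opened := 0
  hand := none
  ground := 0
  visited := {0}
  time := 0
  partC := none

/-- The walker's place on the circuit. -/
noncomputable def ExpeditionState.place (s : ExpeditionState) : AddCircle (5 : ℝ) :=
  (s.pos : AddCircle (5 : ℝ))

/-- The circuit is completed: the whole of it has been visited, and the walker is at the base. -/
def ExpeditionState.Completed (s : ExpeditionState) : Prop :=
  s.place = 0 ∧ s.visited = Set.univ

/-- The actions that are possible in state `s`. A walk that passes the base is written as two
walks. The expedition ends as soon as the circuit is completed. -/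
def ExpeditionState.Allows (s : ExpeditionState) (a : ExpeditionAction) : Prop :=
  ¬ s.Completed ∧
  match a with
  | .walk y => |y - s.pos| ≤ s.opened ∧
      ((0 ≤ s.pos ∧ 0 ≤ y ∧ y ≤ 5) ∨ (s.pos ≤ 0 ∧ y ≤ 0 ∧ -5 ≤ y))
  | .take o => s.hand = none ∧ (s.place = 0 ∨ (o, s.place) ∈ s.ground)
  | .drop => s.hand ≠ none
  | .unpack => s.hand ≠ none

open scoped Classical in
/-- The effect of an action, when walking starts at clock time `start`. Unsealing a box replaces
the previous unsealed box, the rest of which is thrown away. A box taken at the base gets its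
origin when the walker leaves the base. -/
noncomputable def ExpeditionState.next (conv : Convention) (start : ℝ) (s : ExpeditionState) :
    ExpeditionAction → ExpeditionState
  | .walk y =>
      { s with
        pos := y
        opened := s.opened - |y - s.pos|
        hand := if s.pos = 0 then s.hand.map (fun _ => SignType.sign y) else s.hand
        visited := s.visited ∪ (fun x : ℝ => (x : AddCircle (5 : ℝ))) '' Set.uIcc s.pos y
        time := s.time + |y - s.pos|
        partC := if y = 0 then none else s.partC }
  | .take o =>
      if s.place = 0 then { s with hand := some 0 }
      else { s with hand := some o, ground := s.ground.erase (o, s.place) }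
  | .drop =>
      match s.hand with
      | none => s
      | some o => { s with hand := none, ground := (o, s.place) ::ₘ s.ground }
  | .unpack =>
      match s.hand with
      | none => s
      | some o =>
        { s with
          hand := none
          opened := conv.portion (start + s.time)
          partC := match s.partC with
            | some (t, n) => some (t, n + 1)
            | none => if o * SignType.sign s.pos = -1 then some (s.time, 1) else none }

/-- The charge in Cole's way of measuring. Part C of the expedition is the part of the final trip
that begins when, for the first time on that trip, a box is unsealed that was taken away from the
base in the direction opposite to that trip. The field `partC` records the moment at which part C
begins and the number of boxes unsealed in it (and is cleared when the walker turns back to the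
base without having gone round). The charge is the time before part C plus the number of boxes
unsealed in part C; it is the total time if there is no part C. -/
noncomputable def ExpeditionState.cole (s : ExpeditionState) : ℝ :=
  match s.partC with
  | none => s.time
  | some (t, n) => t + n

/-- The state after the actions of a plan. -/
noncomputable def ExpeditionState.run (conv : Convention) (start : ℝ) (s : ExpeditionState)
    (plan : List ExpeditionAction) : ExpeditionState :=
  plan.foldl (ExpeditionState.next conv start) s

/-- All actions of the plan are possible, one after the other. -/
def ExpeditionState.Feasible (conv : Convention) (start : ℝ) :
    ExpeditionState → List ExpeditionAction → Prop
  | _, [] => True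
  | s, a :: plan => s.Allows a ∧ Feasible conv start (s.next conv start a) plan

/-- The state at the end of a plan that is carried out from the beginning. -/
noncomputable def outcome (conv : Convention) (start : ℝ) (plan : List ExpeditionAction) :
    ExpeditionState :=
  ExpeditionState.initial.run conv start plan

/-- The plan can be carried out, and completes the circuit. -/
def Solves (conv : Convention) (start : ℝ) (plan : List ExpeditionAction) : Prop :=
  ExpeditionState.initial.Feasible conv start plan ∧ (outcome conv start plan).Completed

section Algorithm
open ExpeditionAction

/-- Take a box and open it, then take another one. -/
def load (o : SignType) : List ExpeditionAction := [take o, unpack, take o]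

/-- Pick up a box of origin `o`, bring it to `y` and dump it there. -/
def fetch (o : SignType) (y : ℝ) : List ExpeditionAction := [take o, walk y, drop]

/-- Part A: boxes are dumped on the far side for later use. The point at `m` miles
(`80 ≤ m ≤ 100`, five units being a hundred miles) has coordinate `(m - 100) / 20`. -/
noncomputable def bestPartA : List ExpeditionAction :=
  load 0 ++ [walk (-1/16), drop, walk 0] ++
  load 0 ++ [walk (-1/8), drop, walk (-1/16)] ++ fetch (-1) (-7/16) ++ [walk 0] ++
  load 0 ++ [walk (-5/16), drop, walk (-1/8)] ++ fetch (-1) (-5/16) ++ [walk 0] ++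
  load 0 ++ [walk (-1/2), drop, walk 0] ++
  load 0 ++ [walk (-1/2), drop, walk 0] ++
  load 0 ++ [walk (-21/32), drop, walk (-5/16)] ++
  load (-1) ++ [walk (-7/8), drop, walk (-21/32)] ++ fetch (-1) (-11/16) ++ [walk (-1/2)] ++
  load (-1) ++ [walk (-1), drop, walk (-11/16), take (-1), walk (-7/8)] ++
  [unpack, take (-1), walk (-23/16), drop, walk (-1)] ++
  [take (-1), unpack, walk 0]

/-- Part B: the way around to the place of the first box left for part C. The point at `m` miles
has coordinate `m / 20`. -/
noncomputable def bestPartB : List ExpeditionAction :=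
  load 0 ++ [walk (1/2), drop, walk 0] ++
  load 0 ++ [walk (1/2), drop, walk 0] ++
  load 0 ++ [walk (1/2), drop, walk 0] ++
  load 0 ++ [walk (1/2), drop, walk 0] ++
  load 0 ++ [walk (1/2), drop, walk 0] ++
  load 0 ++ [walk (5/8), drop, walk (1/2)] ++ fetch 1 (5/8) ++ [walk (1/2)] ++
  load 1 ++ [walk 1, drop, walk (1/2)] ++
  load 1 ++ [walk (33/32), drop, walk 1] ++ fetch 1 (33/32) ++ [walk (5/8)] ++
  load 1 ++ [walk (85/64), drop, walk (33/32)] ++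
  load 1 ++ [walk (25/16), drop, walk (85/64), take 1, walk (25/16)] ++
  [unpack, take 1, walk (41/16), unpack, walk (57/16)]

/-- Part C: the last part of the way, on the boxes left behind in part A. -/
noncomputable def bestPartC : List ExpeditionAction :=
  [take (-1), unpack, walk (73/16), take (-1), unpack, walk 5]

/-- The algorithm of `22 9/16` days. -/
noncomputable def bestAlgorithm : List ExpeditionAction := bestPartA ++ bestPartB ++ bestPartC

end Algorithm

/-! The lower bounds are linear programming duality. Every sealed box gets a price depending on its
place and origin, and the walker gets a potential depending on his position and open ration. `slack`
is the elapsed time minus all of these. Prices and potentials are chosen so that no action lowers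
the slack (`OutLaw`, `InLaw`, `UnpackLaw`); hence the time is at least the stock plus the potential.
Of the convention and the starting moment only `portion_mem` is used, so all cases are treated at
once.

By reflection, an expedition that goes round may be assumed to end at coordinate `5`. Consider the
point `z` where a box from the far side is first unsealed on the way out. The total splits into the
cost of reaching `z` (`out`), the cost of having one box at distance `5 - z` on the far side
(`worth`), and what is still to come (`aft`). Far boxes have a low price, and only the box that is
unsealed needs the higher `worth`. The difference is obtained when a box is dropped there: the
walker's potential is then lowered from `far` to `back` (`Scheme.drop`, `Prepared.next`).

Around the critical point `57/16`, reaching `z` costs at the rate 14 in `scheme14` and 16 in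
`scheme16`; `worth` falls at the rate 12 and `aft` rises at the rate 3. As 14 - 12 < 3 < 16 - 12,
the first scheme serves below `57/16` and the second above; at `57/16` both give exactly `361/16`.
For Cole's measure `scheme14` gives `185/8` for `z ≤ 3` by the time itself. Between 3 and 4 it gives
`185/8` by counting a necessary second box (`OneOpened`). From 4 on, one box may be enough and
`scheme6` applies.

The remaining expeditions are excluded by a cruder system, in which a box costs twice its distance
from the base. An excursion to distance `p` and back then costs `tripCost p`, which is at least 12
from half way on, and going round costs 12 as well. Not going round at all, or going round after a
lost excursion to half way, therefore takes at least 24 days. `Invariant` joins these cases as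
`Lost`, `Early` and `Late`.

The bounds are attained: the given algorithm moves on multiples of `1/64`, so its run is computed in
integers and transferred (`Describes.run`). -/

/-! ### Laws for potential functions of a walker -/

/-- Walking outward with a box that is worth `V x` at `x`: the potential `P x r` of a walker at `x`
with opened ration `r`, together with the price of the box, grows at most by the distance walked. -/
def OutLaw (P : ℝ → ℝ → ℝ) (V : ℝ → ℝ) (a b : ℝ) : Prop :=
  ∀ x y r, a ≤ x → x ≤ y → y ≤ b → y - x ≤ r → r ≤ 1 →
    P y (r - (y - x)) + V y ≤ P x r + V x + (y - x)

/-- The same for walking inward. -/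
def InLaw (P : ℝ → ℝ → ℝ) (V : ℝ → ℝ) (a b : ℝ) : Prop :=
  ∀ x y r, a ≤ x → x ≤ y → y ≤ b → y - x ≤ r → r ≤ 1 →
    P x (r - (y - x)) + V x ≤ P y r + V y + (y - x)

/-- Unsealing a box raises the potential at most by the price of the box. -/
def UnpackLaw (P : ℝ → ℝ → ℝ) (V : ℝ → ℝ) (a b : ℝ) : Prop :=
  ∀ x r r', a ≤ x → x ≤ b → 0 ≤ r → r ≤ 1 → 0 ≤ r' → r' ≤ 1 → P x r' ≤ P x r + V x

/-- A walk across `b` is cut there, and rations and distances add up. The laws can thus be checked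
on each interval where price and potential have a single formula. -/
theorem OutLaw.trans {P V a b c} (h : OutLaw P V a b) (h' : OutLaw P V b c) :
    OutLaw P V a c := by
  intro x y r hx hxy hy hr hr1
  rcases le_total y b with hyb | hyb
  · exact h x y r hx hxy hyb hr hr1
  rcases le_total b x with hbx | hbx
  · exact h' x y r hbx hxy hy hr hr1
  have h1 := h x b r hx hbx le_rfl (by linarith) hr1
  have h2 := h' b y (r - (b - x)) le_rfl hyb hy (by linarith) (by linarith)
  rw [show r - (b - x) - (y - b) = r - (y - x) by ring] at h2
  linarith

theorem InLaw.trans {P V a b c} (h : InLaw P V a b) (h' : InLaw P V b c) :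
    InLaw P V a c := by
  intro x y r hx hxy hy hr hr1
  rcases le_total y b with hyb | hyb
  · exact h x y r hx hxy hyb hr hr1
  rcases le_total b x with hbx | hbx
  · exact h' x y r hbx hxy hy hr hr1
  have h1 := h' b y r le_rfl hyb hy (by linarith) hr1
  have h2 := h x b (r - (y - b)) hx hbx le_rfl (by linarith) (by linarith)
  rw [show r - (y - b) - (b - x) = r - (y - x) by ring] at h2
  linarith

theorem UnpackLaw.trans {P V a b c} (h : UnpackLaw P V a b) (h' : UnpackLaw P V b c) :
    UnpackLaw P V a c := by
  intro x r r' hx hy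
  rcases le_total x b with hxb | hxb
  · exact h x r r' hx hxb
  · exact h' x r r' hxb hy

/-! ### Prices of boxes -/

/-- Price of a box on the way out. -/
noncomputable def price16 (x : ℝ) : ℝ :=
  min 15 (max (max (2 * x) (4 * x - 1)) (max (16/3 * x - 7/3) (32/3 * x - 9)))

/-- Price of a box on the way out. -/
noncomputable def price14 (x : ℝ) : ℝ :=
  min 13 (max (max (2 * x) (7/2 * x - 3/4)) (max (14/3 * x - 5/3) (28/3 * x - 7)))

/-- Price of a box on the far side. -/
noncomputable def price12 (e : ℝ) : ℝ := min 5 (max (2 * e) (4 * e - 1))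

/-- Price of a box on the far side. -/
noncomputable def price6 (e : ℝ) : ℝ := min (2 * e) 5

/-! ### Potentials -/

/-- Potential of a walker on the way out. -/
noncomputable def out16 (x r : ℝ) : ℝ :=
  if x ≤ 1/2 then max (r - 1) (min (-x) (r - 2 * x))
  else if x ≤ 1 then
    max (min (r - 2 * x) (5/3 * r - 8/3 * x + 1/3)) (13/3 * r + 4/3 * x - 5)
  else if x ≤ 5/4 then
    max (min (5/3 * r - 8/3 * x + 1/3) (13/3 * r - 16/3 * x + 3)) (13/3 * r - 11/3)
  else if x ≤ 9/4 then max (13/3 * r - 16/3 * x + 3) (15 * r + 16/3 * x - 21)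
  else 15 * r + 16 * x - 45

/-- Potential of a walker on the way out. -/
noncomputable def out14 (x r : ℝ) : ℝ :=
  if x ≤ 1/2 then
    max (min (-x) (3/4 * r - 7/4 * x)) (max (3/4 * r - 1/4 * x - 3/4) (4/3 * r + 1/3 * x - 11/8))
  else if x ≤ 11/14 then
    max (min (3/4 * r - 7/4 * x) (4/3 * r - 7/3 * x + 7/24))
      (max (4/3 * r - 7/6 * x - 5/8) (11/3 * r + 7/6 * x - 33/8))
  else if x ≤ 8/7 then
    max (min (4/3 * r - 7/3 * x + 7/24) (11/3 * r - 14/3 * x + 17/8)) (11/3 * r - 77/24)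
  else if x ≤ 15/7 then max (11/3 * r - 14/3 * x + 17/8) (13 * r + 14/3 * x - 143/8)
  else 13 * r + 14 * x - 303/8

/-- Potential of a walker on the far side. -/
noncomputable def far12 (x r : ℝ) : ℝ :=
  if x ≤ 1/2 then max (r - 1) (min (-x) (r - 2 * x))
  else if x ≤ 3/2 then max (r - 2 * x) (5 * r + 2 * x - 6)
  else max (r - 2 * x) (5 * r + 6 * x - 12)

/-- Potential of a walker on the far side who has left a box there. -/
noncomputable def back12 (x r : ℝ) : ℝ :=
  if x ≤ 1/2 then max (r - 1) (min (-x) (r - 2 * x))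
  else min (r - 2 * x) (5 * r - 6 * x + 2)

/-- Potential of a walker on the far side. -/
noncomputable def far6 (x r : ℝ) : ℝ := -x + 2 * max 0 (x + r - 1)

/-- Potential of a walker on the far side who has left a box there. -/
noncomputable def back6 (x r : ℝ) : ℝ := -x - 2 * max 0 (x - r)

/-! ### Formulas for prices and potentials on closed zones -/

section Zones
variable {x r : ℝ}

theorem price16_one (h : x ≤ 1/2) : price16 x = 2 * x := by
  rw [price16, max_eq_left (by linarith : 4 * x - 1 ≤ 2 * x), max_eq_left, min_eq_right] <;>
    first | linarith | (apply max_le <;> linarith)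

theorem price16_two (h : 1/2 ≤ x) (h' : x ≤ 1) : price16 x = 4 * x - 1 := by
  rw [price16, max_eq_right (by linarith : 2 * x ≤ 4 * x - 1), max_eq_left, min_eq_right] <;>
    first | linarith | (apply max_le <;> linarith)

theorem price16_three (h : 1 ≤ x) (h' : x ≤ 5/4) : price16 x = 16/3 * x - 7/3 := by
  rw [price16, max_eq_left (by linarith : 32/3 * x - 9 ≤ 16/3 * x - 7/3), max_eq_right,
    min_eq_right] <;>
    first | linarith | (apply max_le <;> linarith)

theorem price16_four (h : 5/4 ≤ x) (h' : x ≤ 9/4) : price16 x = 32/3 * x - 9 := by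
  rw [price16, max_eq_right (by linarith : 16/3 * x - 7/3 ≤ 32/3 * x - 9), max_eq_right,
    min_eq_right] <;>
    first | linarith | (apply max_le <;> linarith)

theorem price16_five (h : 9/4 ≤ x) : price16 x = 15 := by
  rw [price16, min_eq_left]
  exact le_max_of_le_right (le_max_of_le_right (by linarith))

theorem price14_one (h : x ≤ 1/2) : price14 x = 2 * x := by
  rw [price14, max_eq_left (by linarith : 7/2 * x - 3/4 ≤ 2 * x), max_eq_left, min_eq_right] <;>
    first | linarith | (apply max_le <;> linarith)

theorem price14_two (h : 1/2 ≤ x) (h' : x ≤ 11/14) : price14 x = 7/2 * x - 3/4 := by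
  rw [price14, max_eq_right (by linarith : 2 * x ≤ 7/2 * x - 3/4), max_eq_left, min_eq_right] <;>
    first | linarith | (apply max_le <;> linarith)

theorem price14_three (h : 11/14 ≤ x) (h' : x ≤ 8/7) : price14 x = 14/3 * x - 5/3 := by
  rw [price14, max_eq_left (by linarith : 28/3 * x - 7 ≤ 14/3 * x - 5/3), max_eq_right,
    min_eq_right] <;>
    first | linarith | (apply max_le <;> linarith)

theorem price14_four (h : 8/7 ≤ x) (h' : x ≤ 15/7) : price14 x = 28/3 * x - 7 := by
  rw [price14, max_eq_right (by linarith : 14/3 * x - 5/3 ≤ 28/3 * x - 7), max_eq_right,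
    min_eq_right] <;>
    first | linarith | (apply max_le <;> linarith)

theorem price14_five (h : 15/7 ≤ x) : price14 x = 13 := by
  rw [price14, min_eq_left]
  exact le_max_of_le_right (le_max_of_le_right (by linarith))

theorem price12_one (h : x ≤ 1/2) : price12 x = 2 * x := by
  rw [price12, max_eq_left (by linarith), min_eq_right (by linarith)]

theorem price12_two (h : 1/2 ≤ x) (h' : x ≤ 3/2) : price12 x = 4 * x - 1 := by
  rw [price12, max_eq_right (by linarith), min_eq_right (by linarith)]

theorem price12_three (h : 3/2 ≤ x) : price12 x = 5 := by
  rw [price12, min_eq_left]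
  exact le_max_of_le_right (by linarith)

theorem out16_one (h : x ≤ 1/2) : out16 x r = max (r - 1) (min (-x) (r - 2 * x)) := by
  rw [out16, if_pos h]

/-- At the left endpoint the definition uses the branch of the previous zone. The two formulas agree
there for rations in `[0, 1]`, so each formula holds on its closed zone and neighbouring zones can
be glued. The same applies to the later zones and potentials. -/
theorem out16_two (h : 1/2 ≤ x) (h' : x ≤ 1) (hr : 0 ≤ r) (hr' : r ≤ 1) :
    out16 x r = max (min (r - 2 * x) (5/3 * r - 8/3 * x + 1/3)) (13/3 * r + 4/3 * x - 5) := by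
  rcases eq_or_lt_of_le h with h | h
  · subst h
    rw [out16, if_pos le_rfl]
    grind
  · rw [out16, if_neg (by linarith), if_pos h']

theorem out16_three (h : 1 ≤ x) (h' : x ≤ 5/4) (hr : 0 ≤ r) (hr' : r ≤ 1) :
    out16 x r =
      max (min (5/3 * r - 8/3 * x + 1/3) (13/3 * r - 16/3 * x + 3)) (13/3 * r - 11/3) := by
  rcases eq_or_lt_of_le h with h | h
  · subst h
    rw [out16_two (by norm_num) le_rfl hr hr']
    grind
  · rw [out16, if_neg (by linarith), if_neg (by linarith), if_pos h']

theorem out16_four (h : 5/4 ≤ x) (h' : x ≤ 9/4) (hr : 0 ≤ r) (hr' : r ≤ 1) :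
    out16 x r = max (13/3 * r - 16/3 * x + 3) (15 * r + 16/3 * x - 21) := by
  rcases eq_or_lt_of_le h with h | h
  · subst h
    rw [out16_three (by norm_num) le_rfl hr hr']
    grind
  · rw [out16, if_neg (by linarith), if_neg (by linarith), if_neg (by linarith), if_pos h']

theorem out16_five (h : 9/4 ≤ x) (hr : 0 ≤ r) (hr' : r ≤ 1) :
    out16 x r = 15 * r + 16 * x - 45 := by
  rcases eq_or_lt_of_le h with h | h
  · subst h
    rw [out16_four (by norm_num) le_rfl hr hr']
    grind
  · rw [out16, if_neg (by linarith), if_neg (by linarith), if_neg (by linarith),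
      if_neg (by linarith)]

theorem out14_one (h : x ≤ 1/2) : out14 x r =
    max (min (-x) (3/4 * r - 7/4 * x))
      (max (3/4 * r - 1/4 * x - 3/4) (4/3 * r + 1/3 * x - 11/8)) := by
  rw [out14, if_pos h]

theorem out14_two (h : 1/2 ≤ x) (h' : x ≤ 11/14) (hr : 0 ≤ r) (hr' : r ≤ 1) : out14 x r =
    max (min (3/4 * r - 7/4 * x) (4/3 * r - 7/3 * x + 7/24))
      (max (4/3 * r - 7/6 * x - 5/8) (11/3 * r + 7/6 * x - 33/8)) := by
  rcases eq_or_lt_of_le h with h | h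
  · subst h
    rw [out14, if_pos le_rfl]
    grind
  · rw [out14, if_neg (by linarith), if_pos h']

theorem out14_three (h : 11/14 ≤ x) (h' : x ≤ 8/7) (hr : 0 ≤ r) (hr' : r ≤ 1) : out14 x r =
    max (min (4/3 * r - 7/3 * x + 7/24) (11/3 * r - 14/3 * x + 17/8)) (11/3 * r - 77/24) := by
  rcases eq_or_lt_of_le h with h | h
  · subst h
    rw [out14_two (by norm_num) le_rfl hr hr']
    grind
  · rw [out14, if_neg (by linarith), if_neg (by linarith), if_pos h']

theorem out14_four (h : 8/7 ≤ x) (h' : x ≤ 15/7) (hr : 0 ≤ r) (hr' : r ≤ 1) :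
    out14 x r = max (11/3 * r - 14/3 * x + 17/8) (13 * r + 14/3 * x - 143/8) := by
  rcases eq_or_lt_of_le h with h | h
  · subst h
    rw [out14_three (by norm_num) le_rfl hr hr']
    grind
  · rw [out14, if_neg (by linarith), if_neg (by linarith), if_neg (by linarith), if_pos h']

theorem out14_five (h : 15/7 ≤ x) (hr : 0 ≤ r) (hr' : r ≤ 1) :
    out14 x r = 13 * r + 14 * x - 303/8 := by
  rcases eq_or_lt_of_le h with h | h
  · subst h
    rw [out14_four (by norm_num) le_rfl hr hr']
    grind
  · rw [out14, if_neg (by linarith), if_neg (by linarith), if_neg (by linarith),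
      if_neg (by linarith)]

theorem far12_one (h : x ≤ 1/2) : far12 x r = max (r - 1) (min (-x) (r - 2 * x)) := by
  rw [far12, if_pos h]

theorem far12_two (h : 1/2 ≤ x) (h' : x ≤ 3/2) (_hr : 0 ≤ r) (hr' : r ≤ 1) :
    far12 x r = max (r - 2 * x) (5 * r + 2 * x - 6) := by
  rcases eq_or_lt_of_le h with h | h
  · subst h
    rw [far12, if_pos le_rfl]
    grind
  · rw [far12, if_neg (by linarith), if_pos h']

theorem far12_three (h : 3/2 ≤ x) (hr : 0 ≤ r) (hr' : r ≤ 1) :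
    far12 x r = max (r - 2 * x) (5 * r + 6 * x - 12) := by
  rcases eq_or_lt_of_le h with h | h
  · subst h
    rw [far12_two (by norm_num) le_rfl hr hr']
    grind
  · rw [far12, if_neg (by linarith), if_neg (by linarith)]

theorem back12_one (h : x ≤ 1/2) : back12 x r = max (r - 1) (min (-x) (r - 2 * x)) := by
  rw [back12, if_pos h]

theorem back12_two (h : 1/2 ≤ x) (hr : 0 ≤ r) (_hr' : r ≤ 1) :
    back12 x r = min (r - 2 * x) (5 * r - 6 * x + 2) := by
  rcases eq_or_lt_of_le h with h | h
  · subst h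
    rw [back12, if_pos le_rfl]
    grind
  · rw [back12, if_neg (by linarith)]

end Zones

/-! ### The laws, zone by zone, as piecewise linear inequalities -/

theorem out16_outLaw_one : OutLaw out16 price16 (0) (1/2) := by
  intro x y r hx hxy hy hr hr1
  rw [out16_one (hxy.trans hy),
    out16_one hy,
    price16_one (hxy.trans hy), price16_one hy]
  grind

theorem out16_unpackLaw_one : UnpackLaw out16 price16 (0) (1/2) := by
  intro x r r' hx hy h0 h1 h0' h1'
  rw [out16_one hy, out16_one hy, price16_one hy]
  grind

theorem out16_outLaw_two : OutLaw out16 price16 (1/2) (1) := by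
  intro x y r hx hxy hy hr hr1
  rw [out16_two hx (hxy.trans hy) (by linarith) hr1,
    out16_two (hx.trans hxy) hy (by linarith) (by linarith),
    price16_two hx (hxy.trans hy), price16_two (hx.trans hxy) hy]
  grind

theorem out16_unpackLaw_two : UnpackLaw out16 price16 (1/2) (1) := by
  intro x r r' hx hy h0 h1 h0' h1'
  rw [out16_two hx hy h0 h1, out16_two hx hy h0' h1', price16_two hx hy]
  grind

theorem out16_outLaw_three : OutLaw out16 price16 (1) (5/4) := by
  intro x y r hx hxy hy hr hr1
  rw [out16_three hx (hxy.trans hy) (by linarith) hr1,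
    out16_three (hx.trans hxy) hy (by linarith) (by linarith),
    price16_three hx (hxy.trans hy), price16_three (hx.trans hxy) hy]
  grind

theorem out16_unpackLaw_three : UnpackLaw out16 price16 (1) (5/4) := by
  intro x r r' hx hy h0 h1 h0' h1'
  rw [out16_three hx hy h0 h1, out16_three hx hy h0' h1', price16_three hx hy]
  grind

theorem out16_outLaw_four : OutLaw out16 price16 (5/4) (9/4) := by
  intro x y r hx hxy hy hr hr1
  rw [out16_four hx (hxy.trans hy) (by linarith) hr1,
    out16_four (hx.trans hxy) hy (by linarith) (by linarith),
    price16_four hx (hxy.trans hy), price16_four (hx.trans hxy) hy]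
  grind

theorem out16_unpackLaw_four : UnpackLaw out16 price16 (5/4) (9/4) := by
  intro x r r' hx hy h0 h1 h0' h1'
  rw [out16_four hx hy h0 h1, out16_four hx hy h0' h1', price16_four hx hy]
  grind

theorem out16_outLaw_five : OutLaw out16 price16 (9/4) (5) := by
  intro x y r hx hxy hy hr hr1
  rw [out16_five hx (by linarith) hr1,
    out16_five (hx.trans hxy) (by linarith) (by linarith),
    price16_five hx, price16_five (hx.trans hxy)]
  grind

theorem out16_unpackLaw_five : UnpackLaw out16 price16 (9/4) (5) := by
  intro x r r' hx hy h0 h1 h0' h1'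
  rw [out16_five hx h0 h1, out16_five hx h0' h1', price16_five hx]
  grind

theorem out16_inLaw_one : InLaw out16 0 (0) (1/2) := by
  intro x y r hx hxy hy hr hr1
  rw [out16_one (hxy.trans hy),
    out16_one hy]
  simp only [Pi.zero_apply, add_zero]
  grind

theorem out16_inLaw_two : InLaw out16 0 (1/2) (1) := by
  intro x y r hx hxy hy hr hr1
  rw [out16_two hx (hxy.trans hy) (by linarith) (by linarith),
    out16_two (hx.trans hxy) hy (by linarith) hr1]
  simp only [Pi.zero_apply, add_zero]
  grind

theorem out16_inLaw_three : InLaw out16 0 (1) (5/4) := by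
  intro x y r hx hxy hy hr hr1
  rw [out16_three hx (hxy.trans hy) (by linarith) (by linarith),
    out16_three (hx.trans hxy) hy (by linarith) hr1]
  simp only [Pi.zero_apply, add_zero]
  grind

theorem out16_inLaw_four : InLaw out16 0 (5/4) (9/4) := by
  intro x y r hx hxy hy hr hr1
  rw [out16_four hx (hxy.trans hy) (by linarith) (by linarith),
    out16_four (hx.trans hxy) hy (by linarith) hr1]
  simp only [Pi.zero_apply, add_zero]
  grind

theorem out16_inLaw_five : InLaw out16 0 (9/4) (5) := by
  intro x y r hx hxy hy hr hr1
  rw [out16_five hx (by linarith) (by linarith),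
    out16_five (hx.trans hxy) (by linarith) hr1]
  simp only [Pi.zero_apply, add_zero]
  grind

theorem out16_outLaw : OutLaw out16 price16 0 5 :=
  ((((out16_outLaw_one.trans out16_outLaw_two).trans out16_outLaw_three).trans
    out16_outLaw_four).trans out16_outLaw_five)

theorem out16_unpackLaw : UnpackLaw out16 price16 0 5 :=
  ((((out16_unpackLaw_one.trans out16_unpackLaw_two).trans out16_unpackLaw_three).trans
    out16_unpackLaw_four).trans out16_unpackLaw_five)

theorem out16_inLaw : InLaw out16 0 0 5 :=
  ((((out16_inLaw_one.trans out16_inLaw_two).trans out16_inLaw_three).trans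
    out16_inLaw_four).trans out16_inLaw_five)

theorem out14_outLaw_one : OutLaw out14 price14 (0) (1/2) := by
  intro x y r hx hxy hy hr hr1
  rw [out14_one (hxy.trans hy),
    out14_one hy,
    price14_one (hxy.trans hy), price14_one hy]
  grind

theorem out14_unpackLaw_one : UnpackLaw out14 price14 (0) (1/2) := by
  intro x r r' hx hy h0 h1 h0' h1'
  rw [out14_one hy, out14_one hy, price14_one hy]
  grind

theorem out14_outLaw_two : OutLaw out14 price14 (1/2) (11/14) := by
  intro x y r hx hxy hy hr hr1
  rw [out14_two hx (hxy.trans hy) (by linarith) hr1,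
    out14_two (hx.trans hxy) hy (by linarith) (by linarith),
    price14_two hx (hxy.trans hy), price14_two (hx.trans hxy) hy]
  grind

theorem out14_unpackLaw_two : UnpackLaw out14 price14 (1/2) (11/14) := by
  intro x r r' hx hy h0 h1 h0' h1'
  rw [out14_two hx hy h0 h1, out14_two hx hy h0' h1', price14_two hx hy]
  grind

theorem out14_outLaw_three : OutLaw out14 price14 (11/14) (8/7) := by
  intro x y r hx hxy hy hr hr1
  rw [out14_three hx (hxy.trans hy) (by linarith) hr1,
    out14_three (hx.trans hxy) hy (by linarith) (by linarith),
    price14_three hx (hxy.trans hy), price14_three (hx.trans hxy) hy]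
  grind

theorem out14_unpackLaw_three : UnpackLaw out14 price14 (11/14) (8/7) := by
  intro x r r' hx hy h0 h1 h0' h1'
  rw [out14_three hx hy h0 h1, out14_three hx hy h0' h1', price14_three hx hy]
  grind

theorem out14_outLaw_four : OutLaw out14 price14 (8/7) (15/7) := by
  intro x y r hx hxy hy hr hr1
  rw [out14_four hx (hxy.trans hy) (by linarith) hr1,
    out14_four (hx.trans hxy) hy (by linarith) (by linarith),
    price14_four hx (hxy.trans hy), price14_four (hx.trans hxy) hy]
  grind

theorem out14_unpackLaw_four : UnpackLaw out14 price14 (8/7) (15/7) := by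
  intro x r r' hx hy h0 h1 h0' h1'
  rw [out14_four hx hy h0 h1, out14_four hx hy h0' h1', price14_four hx hy]
  grind

theorem out14_outLaw_five : OutLaw out14 price14 (15/7) (5) := by
  intro x y r hx hxy hy hr hr1
  rw [out14_five hx (by linarith) hr1,
    out14_five (hx.trans hxy) (by linarith) (by linarith),
    price14_five hx, price14_five (hx.trans hxy)]
  grind

theorem out14_unpackLaw_five : UnpackLaw out14 price14 (15/7) (5) := by
  intro x r r' hx hy h0 h1 h0' h1'
  rw [out14_five hx h0 h1, out14_five hx h0' h1', price14_five hx]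
  grind

theorem out14_inLaw_one : InLaw out14 0 (0) (1/2) := by
  intro x y r hx hxy hy hr hr1
  rw [out14_one (hxy.trans hy),
    out14_one hy]
  simp only [Pi.zero_apply, add_zero]
  grind

theorem out14_inLaw_two : InLaw out14 0 (1/2) (11/14) := by
  intro x y r hx hxy hy hr hr1
  rw [out14_two hx (hxy.trans hy) (by linarith) (by linarith),
    out14_two (hx.trans hxy) hy (by linarith) hr1]
  simp only [Pi.zero_apply, add_zero]
  grind

theorem out14_inLaw_three : InLaw out14 0 (11/14) (8/7) := by
  intro x y r hx hxy hy hr hr1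
  rw [out14_three hx (hxy.trans hy) (by linarith) (by linarith),
    out14_three (hx.trans hxy) hy (by linarith) hr1]
  simp only [Pi.zero_apply, add_zero]
  grind

theorem out14_inLaw_four : InLaw out14 0 (8/7) (15/7) := by
  intro x y r hx hxy hy hr hr1
  rw [out14_four hx (hxy.trans hy) (by linarith) (by linarith),
    out14_four (hx.trans hxy) hy (by linarith) hr1]
  simp only [Pi.zero_apply, add_zero]
  grind

theorem out14_inLaw_five : InLaw out14 0 (15/7) (5) := by
  intro x y r hx hxy hy hr hr1
  rw [out14_five hx (by linarith) (by linarith),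
    out14_five (hx.trans hxy) (by linarith) hr1]
  simp only [Pi.zero_apply, add_zero]
  grind

theorem out14_outLaw : OutLaw out14 price14 0 5 :=
  ((((out14_outLaw_one.trans out14_outLaw_two).trans out14_outLaw_three).trans
    out14_outLaw_four).trans out14_outLaw_five)

theorem out14_unpackLaw : UnpackLaw out14 price14 0 5 :=
  ((((out14_unpackLaw_one.trans out14_unpackLaw_two).trans out14_unpackLaw_three).trans
    out14_unpackLaw_four).trans out14_unpackLaw_five)

theorem out14_inLaw : InLaw out14 0 0 5 :=
  ((((out14_inLaw_one.trans out14_inLaw_two).trans out14_inLaw_three).trans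
    out14_inLaw_four).trans out14_inLaw_five)

theorem far12_outLaw : OutLaw far12 price12 0 (5/2) := by
  refine (OutLaw.trans (b := 1/2) ?_ ?_).trans (b := 3/2) ?_ <;> intro x y r hx hxy hy hr hr1
  · rw [far12_one hy, far12_one (hxy.trans hy), price12_one hy, price12_one (hxy.trans hy)]
    grind
  · rw [far12_two hx (hxy.trans hy) (by linarith) hr1,
      far12_two (hx.trans hxy) hy (by linarith) (by linarith), price12_two hx (hxy.trans hy),
      price12_two (hx.trans hxy) hy]
    grind
  · rw [far12_three hx (by linarith) hr1, far12_three (hx.trans hxy) (by linarith) (by linarith),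
      price12_three hx, price12_three (hx.trans hxy)]
    grind

theorem far12_inLaw : InLaw far12 0 0 (5/2) := by
  refine (InLaw.trans (b := 1/2) ?_ ?_).trans (b := 3/2) ?_ <;> intro x y r hx hxy hy hr hr1 <;>
    simp only [Pi.zero_apply, add_zero]
  · rw [far12_one hy, far12_one (hxy.trans hy)]
    grind
  · rw [far12_two hx (hxy.trans hy) (by linarith) (by linarith),
      far12_two (hx.trans hxy) hy (by linarith) hr1]
    grind
  · rw [far12_three hx (by linarith) (by linarith), far12_three (hx.trans hxy) (by linarith) hr1]
    grind

theorem far12_unpackLaw : UnpackLaw far12 price12 0 (5/2) := by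
  refine (UnpackLaw.trans (b := 1/2) ?_ ?_).trans (b := 3/2) ?_ <;>
    intro x r r' hx hy h0 h1 h0' h1'
  · rw [far12_one hy, far12_one hy, price12_one hy]
    grind
  · rw [far12_two hx hy h0 h1, far12_two hx hy h0' h1', price12_two hx hy]
    grind
  · rw [far12_three hx h0 h1, far12_three hx h0' h1', price12_three hx]
    grind

theorem back12_outLaw : OutLaw back12 price12 0 (5/2) := by
  refine (OutLaw.trans (b := 1/2) ?_ ?_).trans (b := 3/2) ?_ <;> intro x y r hx hxy hy hr hr1
  · rw [back12_one hy, back12_one (hxy.trans hy), price12_one hy, price12_one (hxy.trans hy)]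
    grind
  · rw [back12_two hx (by linarith) hr1,
      back12_two (hx.trans hxy) (by linarith) (by linarith), price12_two hx (hxy.trans hy),
      price12_two (hx.trans hxy) hy]
    grind
  · rw [back12_two (by linarith) (by linarith) hr1,
      back12_two (by linarith) (by linarith) (by linarith),
      price12_three hx, price12_three (hx.trans hxy)]
    grind

theorem back12_inLaw : InLaw back12 0 0 (5/2) := by
  refine InLaw.trans (b := 1/2) ?_ ?_ <;> intro x y r hx hxy hy hr hr1 <;>
    simp only [Pi.zero_apply, add_zero]
  · rw [back12_one hy, back12_one (hxy.trans hy)]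
    grind
  · rw [back12_two hx (by linarith) (by linarith),
      back12_two (hx.trans hxy) (by linarith) hr1]
    grind

theorem back12_unpackLaw : UnpackLaw back12 price12 0 (5/2) := by
  refine (UnpackLaw.trans (b := 1/2) ?_ ?_).trans (b := 3/2) ?_ <;>
    intro x r r' hx hy h0 h1 h0' h1'
  · rw [back12_one hy, back12_one hy, price12_one hy]
    grind
  · rw [back12_two hx h0 h1, back12_two hx h0' h1', price12_two hx hy]
    grind
  · rw [back12_two (by linarith) h0 h1, back12_two (by linarith) h0' h1', price12_three hx]
    grind

theorem price12_mono : Monotone price12 := by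
  intro x y h
  unfold price12
  gcongr

theorem price6_mono : Monotone price6 := by
  intro x y h
  unfold price6
  gcongr

theorem price14_mono : Monotone price14 := by
  intro x y h
  unfold price14
  gcongr

theorem price16_mono : Monotone price16 := by
  intro x y h
  unfold price16
  gcongr

theorem far6_outLaw : OutLaw far6 price6 0 (5/2) := by
  intro x y r hx hxy hy hr hr1
  unfold far6 price6
  grind

theorem far6_inLaw : InLaw far6 0 0 (5/2) := by
  intro x y r hx hxy hy hr hr1
  simp only [Pi.zero_apply, add_zero, far6]
  grind

theorem far6_unpackLaw : UnpackLaw far6 price6 0 (5/2) := by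
  intro x r r' hx hy h0 h1 h0' h1'
  unfold far6 price6
  grind

theorem back6_outLaw : OutLaw back6 price6 0 (5/2) := by
  intro x y r hx hxy hy hr hr1
  unfold back6 price6
  grind

theorem back6_inLaw : InLaw back6 0 0 (5/2) := by
  intro x y r hx hxy hy hr hr1
  simp only [Pi.zero_apply, add_zero, back6]
  grind

theorem back6_unpackLaw : UnpackLaw back6 price6 0 (5/2) := by
  intro x r r' hx hy h0 h1 h0' h1'
  unfold back6 price6
  grind

/-- Inward with a box whose price rises, if the potential is steep where the price varies. -/
theorem InLaw.of_lipschitz {P : ℝ → ℝ → ℝ} {V : ℝ → ℝ} {b c k : ℝ} (h : InLaw P 0 0 5)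
    (hV : ∀ x ≤ b, V x = V b)
    (hP : ∀ x r, b ≤ x → 0 ≤ r → r ≤ 1 → P x r = k * r + (k + 1) * x + c)
    (hk : ∀ x y, b ≤ x → x ≤ y → V x ≤ V y + (2 * k + 2) * (y - x)) (hb' : b ≤ 5) :
    InLaw P V 0 5 := by
  refine InLaw.trans (b := b) ?_ ?_
  · intro x y r hx hxy hy hr hr1
    have := h x y r hx hxy (hy.trans hb') hr hr1
    rw [hV x (hxy.trans hy), hV y hy]
    simp only [Pi.zero_apply] at this
    linarith
  -- Beyond `b`, walking inward by `d` loses `d` in position and `d` in ration, so the potential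
  -- falls by `(2k+1)d`. With the elapsed time `d` this leaves room for a rise of the price by
  -- `(2k+2)d`.
  · intro x y r hx hxy hy hr hr1
    rw [hP x _ hx (by linarith) (by linarith), hP y r (hx.trans hxy) (by linarith) hr1]
    have := hk x y hx hxy
    linarith

/-! ### Three systems of prices -/

/-- A system of prices and potentials. Boxes whose origin is the far side are priced by `priceFar`
as a function of the distance on that side, the others by `priceOut` as a function of the distance
on the near side; one far box that serves for the last part of the way is credited with `worth`. -/
structure Scheme where
  priceOut : ℝ → ℝ
  priceFar : ℝ → ℝ
  worth : ℝ → ℝ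
  out : ℝ → ℝ → ℝ
  far : ℝ → ℝ → ℝ
  back : ℝ → ℝ → ℝ
  priceOut_zero : priceOut 0 = 0
  priceFar_zero : priceFar 0 = 0
  priceOut_mono : Monotone priceOut
  priceFar_mono : Monotone priceFar
  worth_mono : Monotone worth
  outLaw : OutLaw out priceOut 0 5
  inLaw : InLaw out 0 0 5
  inLaw_far : InLaw out (fun x => priceFar (5 - x)) 0 5
  inLaw_worth : InLaw out (fun x => worth (5 - x)) 0 5
  unpackLaw : UnpackLaw out priceOut 0 5
  far_outLaw : OutLaw far priceFar 0 (5/2)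
  far_inLaw : InLaw far 0 0 (5/2)
  far_unpackLaw : UnpackLaw far priceFar 0 (5/2)
  back_outLaw : OutLaw back priceFar 0 (5/2)
  back_inLaw : InLaw back 0 0 (5/2)
  back_unpackLaw : UnpackLaw back priceFar 0 (5/2)
  drop : ∀ e r, 0 < e → e ≤ 5/2 → 0 ≤ r → r ≤ 1 → worth e + back e r ≤ priceFar e + far e r
  out_zero : ∀ r, 0 ≤ r → r ≤ 1 → out 0 r = 0
  far_zero : ∀ r, 0 ≤ r → r ≤ 1 → far 0 r = 0
  back_zero : ∀ r, 0 ≤ r → r ≤ 1 → back 0 r = 0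
  priceOut_const : ∀ z, 5/2 ≤ z → priceOut z = priceOut 5
  priceFar_le : ∀ e, priceFar e ≤ priceOut 5
  le_priceOut : ∀ z, 0 ≤ z → z ≤ 5 → min (2 * min z (5 - z)) 2 ≤ priceOut z
  le_priceFar : ∀ z, 0 ≤ z → z ≤ 5 → min (2 * min z (5 - z)) 2 ≤ priceFar (5 - z)

theorem price12_le (e : ℝ) : price12 e ≤ 5 := min_le_left _ _

theorem price6_le (e : ℝ) : price6 e ≤ 5 := min_le_right _ _

theorem le_price12 (z : ℝ) : min (2 * min z (5 - z)) 2 ≤ price12 (5 - z) := by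
  unfold price12
  grind

theorem le_price6 (z : ℝ) : min (2 * min z (5 - z)) 2 ≤ price6 (5 - z) := by
  unfold price6
  grind

theorem le_price16 (z : ℝ) : min (2 * min z (5 - z)) 2 ≤ price16 z := by
  unfold price16
  refine le_min ((min_le_right _ _).trans (by norm_num)) (le_max_of_le_left (le_max_of_le_left ?_))
  grind

theorem le_price14 (z : ℝ) : min (2 * min z (5 - z)) 2 ≤ price14 z := by
  unfold price14
  refine le_min ((min_le_right _ _).trans (by norm_num)) (le_max_of_le_left (le_max_of_le_left ?_))
  grind

theorem out16_zero (r : ℝ) (h : 0 ≤ r) (h' : r ≤ 1) : out16 0 r = 0 := by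
  rw [out16_one (by norm_num)]
  grind

theorem out14_zero (r : ℝ) (h : 0 ≤ r) (h' : r ≤ 1) : out14 0 r = 0 := by
  rw [out14_one (by norm_num)]
  grind

theorem far12_zero (r : ℝ) (h : 0 ≤ r) (h' : r ≤ 1) : far12 0 r = 0 := by
  rw [far12_one (by norm_num)]
  grind

theorem back12_zero (r : ℝ) (h : 0 ≤ r) (h' : r ≤ 1) : back12 0 r = 0 := by
  rw [back12_one (by norm_num)]
  grind

theorem far6_zero (r : ℝ) (h' : r ≤ 1) : far6 0 r = 0 := by
  unfold far6
  grind

theorem back6_zero (r : ℝ) (h : 0 ≤ r) : back6 0 r = 0 := by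
  unfold back6
  grind

/-- Beyond `1/2`, bound `far12` below by the branch with `5 * r` and `back12` above by its branch
with `5 * r`. The ration cancels, and the difference together with the price is exactly `12 * e - 9`
in both zones. This fixes the rate 12 of the credit. -/
theorem back12_drop (e r : ℝ) (_he : 0 < e) (_he' : e ≤ 5/2) (h : 0 ≤ r) (h' : r ≤ 1) :
    12 * e - 9 + back12 e r ≤ price12 e + far12 e r := by
  rcases le_total e (1/2) with h1 | h1
  · rw [back12_one h1, far12_one h1, price12_one h1]
    grind
  rcases le_total e (3/2) with h2 | h2
  · rw [back12_two h1 h h', far12_two h1 h2 h h', price12_two h1 h2]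
    grind
  · rw [back12_two h1 h h', far12_three h2 h h', price12_three h2]
    grind

/-- The terms `2 * (e + r - 1)` from `far6` and `2 * (e - r)` from `back6` add up to `4 * e - 2`,
and the price contributes `2 * e`. -/
theorem back6_drop (e r : ℝ) (_he : 0 < e) (_he' : e ≤ 5/2) (_h : 0 ≤ r) (_h' : r ≤ 1) :
    6 * e - 2 + back6 e r ≤ price6 e + far6 e r := by
  unfold back6 far6 price6
  grind

/-- Prices with slope 16 on the way out. -/
noncomputable def scheme16 : Scheme where
  priceOut := price16
  priceFar := price12
  worth e := min (12 * e - 9) 24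
  out := out16
  far := far12
  back := back12
  priceOut_zero := by rw [price16_one (by norm_num)]; norm_num
  priceFar_zero := by rw [price12_one (by norm_num)]; norm_num
  priceOut_mono := price16_mono
  priceFar_mono := price12_mono
  worth_mono x y h := by dsimp only; gcongr
  outLaw := out16_outLaw
  inLaw := out16_inLaw
  inLaw_far := by
    refine out16_inLaw.of_lipschitz (b := 9/4) (k := 15) (c := -45) ?_ ?_ ?_ ?_
    · intro x hx
      rw [price12_three (by linarith), price12_three (by linarith)]
    · intro x r h h0 h1
      rw [out16_five h h0 h1]
      ring
    · intro x y _ _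
      unfold price12
      grind
    · norm_num
  inLaw_worth := by
    -- The cap 24 of `worth` is the value of `12 * e - 9` at `e = 5 - 9/4`. The credit is thus
    -- constant exactly where the potential is not yet steep.
    refine out16_inLaw.of_lipschitz (b := 9/4) (k := 15) (c := -45) ?_ ?_ ?_ ?_
    · intro x hx
      grind
    · intro x r h h0 h1
      rw [out16_five h h0 h1]
      ring
    · intro x y _ _
      grind
    · norm_num
  unpackLaw := out16_unpackLaw
  far_outLaw := far12_outLaw
  far_inLaw := far12_inLaw
  far_unpackLaw := far12_unpackLaw
  back_outLaw := back12_outLaw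
  back_inLaw := back12_inLaw
  back_unpackLaw := back12_unpackLaw
  drop e r he he' h h' :=
    (add_le_add_left (min_le_left _ _) _).trans (back12_drop e r he he' h h')
  out_zero := out16_zero
  far_zero := far12_zero
  back_zero := back12_zero
  priceOut_const z hz := by
    rw [price16_five (by linarith), price16_five (by norm_num)]
  priceFar_le e := by
    rw [price16_five (by norm_num)]
    linarith [price12_le e]
  le_priceOut z _ _ := le_price16 z
  le_priceFar z _ _ := le_price12 z

/-- Prices with slope 14 on the way out. -/
noncomputable def scheme14 : Scheme where
  priceOut := price14
  priceFar := price12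
  worth e := min (12 * e - 9) (177/7)
  out := out14
  far := far12
  back := back12
  priceOut_zero := by rw [price14_one (by norm_num)]; norm_num
  priceFar_zero := by rw [price12_one (by norm_num)]; norm_num
  priceOut_mono := price14_mono
  priceFar_mono := price12_mono
  worth_mono x y h := by dsimp only; gcongr
  outLaw := out14_outLaw
  inLaw := out14_inLaw
  inLaw_far := by
    refine out14_inLaw.of_lipschitz (b := 15/7) (k := 13) (c := -303/8) ?_ ?_ ?_ ?_
    · intro x hx
      rw [price12_three (by linarith), price12_three (by linarith)]
    · intro x r h h0 h1
      rw [out14_five h h0 h1]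
      ring
    · intro x y _ _
      unfold price12
      grind
    · norm_num
  inLaw_worth := by
    -- The cap `177/7` is the value of `12 * e - 9` at `e = 5 - 15/7`.
    refine out14_inLaw.of_lipschitz (b := 15/7) (k := 13) (c := -303/8) ?_ ?_ ?_ ?_
    · intro x hx
      grind
    · intro x r h h0 h1
      rw [out14_five h h0 h1]
      ring
    · intro x y _ _
      grind
    · norm_num
  unpackLaw := out14_unpackLaw
  far_outLaw := far12_outLaw
  far_inLaw := far12_inLaw
  far_unpackLaw := far12_unpackLaw
  back_outLaw := back12_outLaw
  back_inLaw := back12_inLaw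
  back_unpackLaw := back12_unpackLaw
  drop e r he he' h h' :=
    (add_le_add_left (min_le_left _ _) _).trans (back12_drop e r he he' h h')
  out_zero := out14_zero
  far_zero := far12_zero
  back_zero := back12_zero
  priceOut_const z hz := by
    rw [price14_five (by linarith), price14_five (by norm_num)]
  priceFar_le e := by
    rw [price14_five (by norm_num)]
    linarith [price12_le e]
  le_priceOut z _ _ := le_price14 z
  le_priceFar z _ _ := le_price12 z

/-- Prices with slope 14 on the way out and a cheaper box on the far side. -/
noncomputable def scheme6 : Scheme where
  priceOut := price14
  priceFar := price6
  worth e := min (6 * e - 2) 13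
  out := out14
  far := far6
  back := back6
  priceOut_zero := by rw [price14_one (by norm_num)]; norm_num
  priceFar_zero := by rw [price6]; norm_num
  priceOut_mono := price14_mono
  priceFar_mono := price6_mono
  worth_mono x y h := by dsimp only; gcongr
  outLaw := out14_outLaw
  inLaw := out14_inLaw
  inLaw_far := by
    refine out14_inLaw.of_lipschitz (b := 15/7) (k := 13) (c := -303/8) ?_ ?_ ?_ ?_
    · intro x hx
      unfold price6
      grind
    · intro x r h h0 h1
      rw [out14_five h h0 h1]
      ring
    · intro x y _ _
      unfold price6
      grind
    · norm_num
  inLaw_worth := by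
    refine out14_inLaw.of_lipschitz (b := 15/7) (k := 13) (c := -303/8) ?_ ?_ ?_ ?_
    · intro x hx
      grind
    · intro x r h h0 h1
      rw [out14_five h h0 h1]
      ring
    · intro x y _ _
      grind
    · norm_num
  unpackLaw := out14_unpackLaw
  far_outLaw := far6_outLaw
  far_inLaw := far6_inLaw
  far_unpackLaw := far6_unpackLaw
  back_outLaw := back6_outLaw
  back_inLaw := back6_inLaw
  back_unpackLaw := back6_unpackLaw
  drop e r he he' h h' :=
    (add_le_add_left (min_le_left _ _) _).trans (back6_drop e r he he' h h')
  out_zero := out14_zero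
  far_zero r _ := far6_zero r
  back_zero r h _ := back6_zero r h
  priceOut_const z hz := by
    rw [price14_five (by linarith), price14_five (by norm_num)]
  priceFar_le e := by
    rw [price14_five (by norm_num)]
    linarith [price6_le e]
  le_priceOut z _ _ := le_price14 z
  le_priceFar z _ _ := le_price6 z

/-! ### The last part of the way -/

/-- Lower bound for the time of a walker who has opened a box from the far side, if he is to need
at least the time `T`. -/
noncomputable def aft (T z r : ℝ) : ℝ :=
  max (T - (5 - z) - 2 * max 0 (5 - z - r)) (T - 9 - z)

/-- Price of a box on the last part of the way. -/
noncomputable def cheap (c z : ℝ) : ℝ := min (2 * min z (5 - z)) c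

theorem aft_outLaw (T : ℝ) : OutLaw (aft T) (cheap 2) 0 5 := by
  intro x y r hx hxy hy hr hr1
  unfold aft cheap
  grind

theorem aft_inLaw (T : ℝ) : InLaw (aft T) (cheap 2) 0 5 := by
  intro x y r hx hxy hy hr hr1
  unfold aft cheap
  grind

theorem aft_outLaw_zero (T : ℝ) : OutLaw (aft T) 0 0 5 := by
  intro x y r hx hxy hy hr hr1
  simp only [Pi.zero_apply, add_zero, aft]
  grind

theorem aft_inLaw_zero (T : ℝ) : InLaw (aft T) 0 0 5 := by
  intro x y r hx hxy hy hr hr1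
  simp only [Pi.zero_apply, add_zero, aft]
  grind

/-- A new ration raises the first branch of `aft` by at most 2, and near the end by at most `2 * (5
- z)`. For `z ≤ 1`, where the price falls below 2 on the near side, the second branch dominates; it
does not depend on the ration. -/
theorem aft_unpackLaw (T : ℝ) : UnpackLaw (aft T) (cheap 2) 0 5 := by
  intro x r r' hx hy h0 h1 h0' h1'
  unfold aft cheap
  grind

/-- For `r = 0` the right side is `4 * z + 6`. With `r' = 1` the left side has slope 3 up to `z =
4`, and equality holds at `57/16`, where the algorithm unseals its first far box. -/
theorem aft_le_scheme16 {z r r' : ℝ} (hz : 57/16 ≤ z) (_hz' : z ≤ 5) (h0 : 0 ≤ r) (h1 : r ≤ 1)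
    (h1' : r' ≤ 1) : aft (361/16) z r' ≤ scheme16.out z r + scheme16.worth (5 - z) := by
  simp only [scheme16]
  rw [out16_five (by linarith) h0 h1]
  unfold aft
  grind

/-- From `15/7` on the right side has slope 2 in `z` against slope 3 of `aft`, so the inequality
holds up to the crossing point. That point is `57/16` for `T = 361/16` and `3` for `T = 185/8`. -/
theorem aft_le_scheme14 {T z r r' : ℝ} (hz : 0 ≤ z) (h0 : 0 ≤ r) (h1 : r ≤ 1) (h1' : r' ≤ 1)
    (h : T = 361/16 ∧ z ≤ 57/16 ∨ T = 185/8 ∧ z ≤ 3) :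
    aft T z r' ≤ scheme14.out z r + scheme14.worth (5 - z) := by
  simp only [scheme14, aft]
  have hT : T ≤ 185/8 := by rcases h with h | h <;> linarith
  rcases le_total z (1/2) with h2 | h2
  · rw [out14_one h2]
    grind
  rcases le_total z (11/14) with h3 | h3
  · rw [out14_two h2 h3 h0 h1]
    grind
  rcases le_total z (8/7) with h4 | h4
  · rw [out14_three h3 h4 h0 h1]
    grind
  rcases le_total z (15/7) with h5 | h5
  · rw [out14_four h4 h5 h0 h1]
    grind
  · rw [out14_five h5 h0 h1]
    grind

/-- Within one day of the end a single box may suffice, so the time before part C must already be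
`185/8 - 1`. -/
theorem le_scheme6 {z r : ℝ} (hz : 4 ≤ z) (_hz' : z ≤ 5) (h0 : 0 ≤ r) (h1 : r ≤ 1) :
    177/8 ≤ scheme6.out z r + scheme6.worth (5 - z) := by
  simp only [scheme6]
  rw [out14_five (by linarith) h0 h1]
  grind

/-- An equality for `r = 0` on the whole interval. The amount `2 * (5 - z)` is 2, for the two boxes
to be charged, plus the price `2 * (5 - z - 1)` of the second box. -/
theorem le_scheme14 {z r : ℝ} (hz : 3 ≤ z) (_hz' : z ≤ 4) (h0 : 0 ≤ r) (h1 : r ≤ 1) :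
    185/8 - 2 * (5 - z) ≤ scheme14.out z r + scheme14.worth (5 - z) := by
  simp only [scheme14]
  rw [out14_five (by linarith) h0 h1]
  grind

/-! ### The price of reaching a point and returning -/

/-- Lower bound for the time needed to be at distance `s` with the ration gone, apart from boxes
worth twice their distance. -/
noncomputable def reachCost (s : ℝ) : ℝ :=
  min (max (max 0 (2 * s - 2)) (max (4 * s - 6) (6 * s - 12)))
    (min (max (2 * s + 2) (4 * s - 6)) 12)

/-- Lower bound for the time of an excursion to distance `p`. -/
noncomputable def tripCost (p : ℝ) : ℝ :=
  min (max (max 0 (4 * p - 2)) (8 * p - 8)) (min (4 * p + 6) 24)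

theorem reachCost_mono : Monotone reachCost := by
  intro x y h
  unfold reachCost
  gcongr

theorem reachCost_nonneg {s : ℝ} (h : -1 ≤ s) : 0 ≤ reachCost s := by
  refine le_min (le_max_of_le_left (le_max_left _ _)) (le_min (le_max_of_le_left ?_) ?_) <;>
    linarith

theorem reachCost_eq_zero {s : ℝ} (h : -1 ≤ s) (h' : s ≤ 1) : reachCost s = 0 := by
  refine le_antisymm (min_le_of_left_le ?_) (reachCost_nonneg h)
  refine max_le (max_le ?_ ?_) (max_le ?_ ?_) <;> linarith

/-- The property for which `reachCost` is built: a fresh ration at `x` extends the reach from `x` to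
`x + 1`, at the price of a box at `x`. At 5 this accumulates to 0 + 2 + 4 + 4 + 2 = 12. -/
theorem reachCost_add_one {x : ℝ} (h : 0 ≤ x) (h' : x ≤ 5) :
    reachCost (x + 1) ≤ reachCost x + 2 * min x (5 - x) := by
  unfold reachCost
  grind

/-- An excursion is an outward walk and a reversed outward walk that meet at `p`. The reversed walk
arrives with the complementary ration `1 - r`. -/
theorem tripCost_le {p r : ℝ} (hp : 0 ≤ p) (h : 0 ≤ r) (h' : r ≤ 1) :
    tripCost p ≤ reachCost (p + r) + reachCost (p - r + 1) := by
  unfold reachCost tripCost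
  grind

theorem tripCost_nonneg {p : ℝ} (h : 0 ≤ p) : 0 ≤ tripCost p := by
  refine le_min (le_max_of_le_left (le_max_left _ _)) (le_min ?_ ?_) <;> linarith

theorem tripCost_zero : tripCost 0 = 0 := by
  unfold tripCost
  norm_num

/-- The pieces of `tripCost` fit so that equality holds for every splitting `p + q = 5`. -/
theorem le_tripCost_add {p q : ℝ} (hp : 0 ≤ p) (hq : 0 ≤ q) (h : 5 ≤ p + q) :
    24 ≤ tripCost p + tripCost q := by
  unfold tripCost
  grind

theorem le_tripCost {p : ℝ} (hp : 5/2 ≤ p) : 12 ≤ tripCost p := by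
  unfold tripCost
  grind

theorem reachCost_eq {s : ℝ} (h : 9/2 ≤ s) : reachCost s = 12 := by
  unfold reachCost
  grind

/-! ### Walks in either direction -/

/-- Walking either way with a box that is worth `V x` at `x`. -/
def WalkLaw (P : ℝ → ℝ → ℝ) (V : ℝ → ℝ) (a b : ℝ) : Prop :=
  ∀ x y r, a ≤ x → x ≤ b → a ≤ y → y ≤ b → |y - x| ≤ r → r ≤ 1 →
    P y (r - |y - x|) + V y ≤ P x r + V x + |y - x|

theorem OutLaw.walkLaw {P V a b} (h : OutLaw P V a b) (h' : InLaw P V a b) :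
    WalkLaw P V a b := by
  intro x y r hx hx' hy hy' hr hr1
  rcases le_total x y with hxy | hxy
  · rw [abs_of_nonneg (sub_nonneg.2 hxy)] at hr ⊢
    exact h x y r hx hxy hy' hr hr1
  · rw [abs_of_nonpos (sub_nonpos.2 hxy), neg_sub] at hr ⊢
    exact h' y x r hy hxy hx' hr hr1

theorem OutLaw.mono {P V U a b} (h : OutLaw P V a b)
    (hU : ∀ x y, a ≤ x → x ≤ y → y ≤ b → U y - U x ≤ V y - V x) : OutLaw P U a b := by
  intro x y r hx hxy hy hr hr1
  have := h x y r hx hxy hy hr hr1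
  have := hU x y hx hxy hy
  linarith

theorem InLaw.mono {P V U a b} (h : InLaw P V a b)
    (hU : ∀ x y, a ≤ x → x ≤ y → y ≤ b → U x - U y ≤ V x - V y) : InLaw P U a b := by
  intro x y r hx hxy hy hr hr1
  have := h x y r hx hxy hy hr hr1
  have := hU x y hx hxy hy
  linarith

namespace Scheme

variable (S : Scheme)

theorem walk_priceOut : WalkLaw S.out S.priceOut 0 5 :=
  S.outLaw.walkLaw (S.inLaw.mono fun x y _ h _ => by simpa using S.priceOut_mono h)

theorem walk_out : WalkLaw S.out 0 0 5 :=
  (S.outLaw.mono fun x y _ h _ => by simpa using S.priceOut_mono h).walkLaw S.inLaw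

theorem walk_priceFar : WalkLaw S.out (fun x => S.priceFar (5 - x)) 0 5 :=
  (S.outLaw.mono fun x y _ h _ => by
    have := S.priceOut_mono h
    have := S.priceFar_mono (sub_le_sub_left h 5)
    linarith).walkLaw S.inLaw_far

theorem walk_worth : WalkLaw S.out (fun x => S.worth (5 - x)) 0 5 :=
  (S.outLaw.mono fun x y _ h _ => by
    have := S.priceOut_mono h
    have := S.worth_mono (sub_le_sub_left h 5)
    linarith).walkLaw S.inLaw_worth

theorem far_walk_price : WalkLaw S.far S.priceFar 0 (5/2) :=
  S.far_outLaw.walkLaw (S.far_inLaw.mono fun x y _ h _ => by simpa using S.priceFar_mono h)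

theorem far_walk : WalkLaw S.far 0 0 (5/2) :=
  (S.far_outLaw.mono fun x y _ h _ => by simpa using S.priceFar_mono h).walkLaw S.far_inLaw

theorem back_walk_price : WalkLaw S.back S.priceFar 0 (5/2) :=
  S.back_outLaw.walkLaw (S.back_inLaw.mono fun x y _ h _ => by simpa using S.priceFar_mono h)

theorem back_walk : WalkLaw S.back 0 0 (5/2) :=
  (S.back_outLaw.mono fun x y _ h _ => by simpa using S.priceFar_mono h).walkLaw S.back_inLaw

theorem priceOut_nonneg {x : ℝ} (h : 0 ≤ x) : 0 ≤ S.priceOut x :=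
  S.priceOut_zero ▸ S.priceOut_mono h

theorem priceFar_nonneg {x : ℝ} (h : 0 ≤ x) : 0 ≤ S.priceFar x :=
  S.priceFar_zero ▸ S.priceFar_mono h

end Scheme

/-! ### Places on the circuit -/

instance fact_zero_lt_five : Fact ((0 : ℝ) < 5) := ⟨by norm_num⟩

/-- Distance from the base in the positive direction. -/
noncomputable def ahead (p : AddCircle (5 : ℝ)) : ℝ := (AddCircle.equivIco 5 0 p : ℝ)

theorem ahead_nonneg (p : AddCircle (5 : ℝ)) : 0 ≤ ahead p := (AddCircle.equivIco 5 0 p).2.1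

theorem ahead_lt (p : AddCircle (5 : ℝ)) : ahead p < 5 :=
  lt_of_lt_of_eq (AddCircle.equivIco (5 : ℝ) 0 p).2.2 (zero_add 5)

theorem coe_ahead (p : AddCircle (5 : ℝ)) : ((ahead p : ℝ) : AddCircle (5 : ℝ)) = p :=
  (AddCircle.equivIco 5 0).symm_apply_apply p

theorem ahead_coe {x : ℝ} (h : 0 ≤ x) (h' : x < 5) : ahead (x : AddCircle (5 : ℝ)) = x := by
  have : AddCircle.equivIco (5 : ℝ) 0 (x : AddCircle (5 : ℝ)) = ⟨x, h, by simpa using h'⟩ :=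
    (AddCircle.equivIco (5 : ℝ) 0).apply_symm_apply ⟨x, h, by simpa using h'⟩
  rw [ahead, this]

theorem coe_add_five (x : ℝ) : ((x + 5 : ℝ) : AddCircle (5 : ℝ)) = x := by
  rw [AddCircle.coe_add, AddCircle.coe_period, add_zero]

theorem ahead_coe_neg {x : ℝ} (h : -5 ≤ x) (h' : x < 0) :
    ahead (x : AddCircle (5 : ℝ)) = 5 + x := by
  rw [← coe_add_five, ahead_coe (by linarith) (by linarith), add_comm]

theorem ahead_zero : ahead 0 = 0 := by
  simpa using ahead_coe (x := 0) le_rfl (by norm_num)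

theorem coe_five : ((5 : ℝ) : AddCircle (5 : ℝ)) = 0 := AddCircle.coe_period 5

theorem ahead_eq_zero {p : AddCircle (5 : ℝ)} : ahead p = 0 ↔ p = 0 := by
  refine ⟨fun h => ?_, fun h => h ▸ ahead_zero⟩
  rw [← coe_ahead p, h, AddCircle.coe_zero]

theorem coe_eq_zero_iff {x : ℝ} (h : -5 < x) (h' : x < 5) :
    (x : AddCircle (5 : ℝ)) = 0 ↔ x = 0 := by
  refine ⟨fun hx => ?_, fun hx => by rw [hx, AddCircle.coe_zero]⟩
  have h1 := ahead_eq_zero.2 hx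
  rcases lt_or_ge x 0 with h0 | h0
  · rw [ahead_coe_neg h.le h0] at h1
    linarith
  · rwa [ahead_coe h0 h'] at h1

/-! ### Stock and slack -/

namespace ExpeditionState

variable {conv : Convention} {start : ℝ} {s : ExpeditionState} {a : ExpeditionAction}

/-- The total price of the boxes on the ground and in hand. -/
noncomputable def stock (v : SignType → AddCircle (5 : ℝ) → ℝ) (s : ExpeditionState) : ℝ :=
  (s.ground.map fun b => v b.1 b.2).sum + s.hand.elim 0 fun o => v o s.place

/-- What the elapsed time exceeds the prices of the boxes and the potential of the walker by. -/
noncomputable def slack (v : SignType → AddCircle (5 : ℝ) → ℝ) (P : ℝ → ℝ → ℝ)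
    (s : ExpeditionState) : ℝ :=
  s.time - stock v s - P s.pos s.opened

/-- The origin of the box in hand after leaving the place of the walker for `y`. -/
noncomputable def handAfter (s : ExpeditionState) (y : ℝ) : Option SignType :=
  (s.next .discard 0 (.walk y)).hand

theorem handAfter_of_ne (h : s.pos ≠ 0) (y : ℝ) : s.handAfter y = s.hand := by
  simp [handAfter, next, h]

theorem handAfter_of_eq (h : s.pos = 0) (y : ℝ) :
    s.handAfter y = s.hand.map fun _ => SignType.sign y := by
  simp [handAfter, next, h]

/-- A box in hand is relabelled when the walker leaves the base. Since prices vanish at the base,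
the new label may be used at both ends of the walk. -/
theorem slack_walk {v : SignType → AddCircle (5 : ℝ) → ℝ} (hv : ∀ o, v o 0 = 0)
    (P : ℝ → ℝ → ℝ) (y : ℝ) :
    slack v P (s.next conv start (.walk y)) =
      slack v P s + |y - s.pos| + P s.pos s.opened - P y (s.opened - |y - s.pos|) +
      (s.handAfter y).elim 0 (fun o => v o s.pos) - (s.handAfter y).elim 0 fun o => v o y := by
  have h2 : (s.next conv start (.walk y)).hand = s.handAfter y := rfl
  have h3 : s.hand.elim 0 (fun o => v o s.place) =
      (s.handAfter y).elim 0 fun o => v o s.pos := by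
    by_cases h : s.pos = 0
    · rw [handAfter_of_eq h]
      cases s.hand <;> simp [place, h, hv]
    · rw [handAfter_of_ne h]
      rfl
  simp only [slack, stock, h2, h3]
  simp only [next, place]
  ring

theorem stock_take {v : SignType → AddCircle (5 : ℝ) → ℝ} (hv : ∀ o, v o 0 = 0) {o : SignType}
    (h : s.Allows (.take o)) : stock v (s.next conv start (.take o)) = stock v s := by
  obtain ⟨-, h1, h2⟩ := h
  by_cases h0 : s.place = 0
  · have : (s.next conv start (.take o)).place = 0 := by
      simp only [next, h0, if_true]
      exact h0
    simp only [stock, this]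
    simp [next, h0, hv, h1]
  · have h2 := h2.resolve_left h0
    have h3 : (s.next conv start (.take o)).place = s.place := by
      simp only [next, h0, if_false]
      rfl
    simp only [stock, h3]
    simp only [next, h0, if_false, h1, Option.elim]
    conv_rhs => rw [← Multiset.cons_erase h2]
    rw [Multiset.map_cons, Multiset.sum_cons]
    ring

theorem stock_drop {v : SignType → AddCircle (5 : ℝ) → ℝ} :
    stock v (s.next conv start .drop) = stock v s := by
  rcases h : s.hand with _ | o
  · simp [next, h]
  · simp [stock, next, h, place, add_comm]

theorem slack_take {v : SignType → AddCircle (5 : ℝ) → ℝ} (hv : ∀ o, v o 0 = 0)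
    (P : ℝ → ℝ → ℝ) {o : SignType} (h : s.Allows (.take o)) :
    slack v P (s.next conv start (.take o)) = slack v P s := by
  have : (s.next conv start (.take o)).time = s.time ∧
      (s.next conv start (.take o)).pos = s.pos ∧
      (s.next conv start (.take o)).opened = s.opened := by
    by_cases h0 : s.place = 0 <;> simp [next, h0]
  rw [slack, stock_take hv h, this.1, this.2.1, this.2.2, slack]

theorem slack_drop {v : SignType → AddCircle (5 : ℝ) → ℝ} (P : ℝ → ℝ → ℝ) :
    slack v P (s.next conv start .drop) = slack v P s := by
  have : (s.next conv start .drop).time = s.time ∧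
      (s.next conv start .drop).pos = s.pos ∧
      (s.next conv start .drop).opened = s.opened := by
    rcases h : s.hand with _ | o <;> simp [next, h]
  rw [slack, stock_drop, this.1, this.2.1, this.2.2, slack]

theorem slack_unpack {v : SignType → AddCircle (5 : ℝ) → ℝ} (P : ℝ → ℝ → ℝ) {o : SignType}
    (h : s.hand = some o) :
    slack v P (s.next conv start .unpack) =
      slack v P s + v o s.pos + P s.pos s.opened - P s.pos (conv.portion (start + s.time)) := by
  simp only [slack, stock, next, h, place, Option.elim]
  ring

/-! ### Elementary invariants -/

/-- The only fact about the conventions that enters the lower bounds. -/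
theorem portion_mem (conv : Convention) (c : ℝ) : 0 ≤ conv.portion c ∧ conv.portion c ≤ 1 := by
  cases conv
  · simp [Convention.portion]
  · simp only [Convention.portion]
    exact ⟨by linarith [Int.fract_lt_one c], by linarith [Int.fract_nonneg c]⟩

/-- Elementary bounds for the position and the opened ration. -/
structure Bounded (s : ExpeditionState) : Prop where
  opened_nonneg : 0 ≤ s.opened
  opened_le : s.opened ≤ 1
  le_pos : -5 ≤ s.pos
  pos_le : s.pos ≤ 5
  visited : (fun x : ℝ => (x : AddCircle (5 : ℝ))) '' Set.uIcc 0 s.pos ⊆ s.visited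
  time_le_cole : s.partC = none ∨ s.time + s.opened ≤ s.cole

theorem bounded_initial : initial.Bounded where
  opened_nonneg := le_rfl
  opened_le := zero_le_one
  le_pos := by norm_num [initial]
  pos_le := by norm_num [initial]
  visited := by simp [initial]
  time_le_cole := Or.inl rfl

/-- The whole interval from 0 to the current coordinate has been visited. Consequently the
coordinate lies strictly between -5 and 5 whenever an action is allowed, and the walker is at the
base only at coordinate 0. -/
theorem Bounded.completed (h : s.Bounded) (h' : |s.pos| = 5) : s.Completed := by
  have hu : (fun x : ℝ => (x : AddCircle (5 : ℝ))) '' Set.uIcc 0 s.pos = Set.univ := by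
    refine Set.eq_univ_of_forall fun p => ?_
    rcases (abs_eq (by norm_num : (0 : ℝ) ≤ 5)).1 h' with h5 | h5
    · refine ⟨ahead p, ?_, coe_ahead p⟩
      rw [h5, Set.uIcc_of_le (by norm_num)]
      exact ⟨ahead_nonneg p, (ahead_lt p).le⟩
    · refine ⟨ahead p - 5, ?_, ?_⟩
      · rw [h5, Set.uIcc_of_ge (by norm_num)]
        exact ⟨by linarith [ahead_nonneg p], by linarith [ahead_lt p]⟩
      · dsimp only
        rw [← coe_add_five, sub_add_cancel, coe_ahead]
  refine ⟨?_, Set.eq_univ_of_univ_subset (hu ▸ h.visited)⟩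
  rcases (abs_eq (by norm_num : (0 : ℝ) ≤ 5)).1 h' with h5 | h5
  · rw [place, h5, coe_five]
  · rw [place, h5, AddCircle.coe_neg, coe_five, neg_zero]

theorem Bounded.abs_pos_lt (h : s.Bounded) (h' : s.Allows a) : |s.pos| < 5 :=
  lt_of_le_of_ne (abs_le.2 ⟨h.le_pos, h.pos_le⟩) fun h5 => h'.1 (h.completed h5)

theorem Bounded.place_eq_zero (h : s.Bounded) (h' : s.Allows a) : s.place = 0 ↔ s.pos = 0 :=
  coe_eq_zero_iff (abs_lt.1 (h.abs_pos_lt h')).1 (abs_lt.1 (h.abs_pos_lt h')).2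

theorem Bounded.next (h : s.Bounded) (ha : s.Allows a) : (s.next conv start a).Bounded := by
  have hlt := abs_lt.1 (h.abs_pos_lt ha)
  cases a with
  | walk y =>
    obtain ⟨-, h1, h2⟩ := ha
    have hy : -5 ≤ y ∧ y ≤ 5 := by
      rcases h2 with ⟨_, _, _⟩ | ⟨_, _, _⟩ <;> constructor <;> linarith
    refine ⟨?_, ?_, hy.1, hy.2, ?_, ?_⟩
    · simpa [ExpeditionState.next] using h1
    · have := abs_nonneg (y - s.pos)
      have := h.opened_le
      simp only [ExpeditionState.next]
      linarith
    · simp only [ExpeditionState.next]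
      refine (Set.image_mono (Set.uIcc_subset_uIcc_union_uIcc (b := s.pos))).trans ?_
      rw [Set.image_union]
      exact Set.union_subset_union_left _ h.visited
    · by_cases h0 : y = 0
      · left
        simp [ExpeditionState.next, h0]
      · rcases h.time_le_cole with h3 | h3
        · left
          simp [ExpeditionState.next, h0, h3]
        · rcases hC : s.partC with _ | ⟨t, n⟩
          · left
            simp [ExpeditionState.next, hC]
          · right
            simp only [ExpeditionState.next, h0, if_false, cole, hC] at h3 ⊢
            linarith
  | take o =>
    by_cases h0 : s.place = 0
    · simp only [ExpeditionState.next, h0, if_true]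
      exact ⟨h.1, h.2, h.3, h.4, h.5, h.6⟩
    · simp only [ExpeditionState.next, h0, if_false]
      exact ⟨h.1, h.2, h.3, h.4, h.5, h.6⟩
  | drop =>
    rcases hh : s.hand with _ | o
    · simpa only [ExpeditionState.next, hh] using h
    · simp only [ExpeditionState.next, hh]
      exact ⟨h.1, h.2, h.3, h.4, h.5, h.6⟩
  | unpack =>
    rcases hh : s.hand with _ | o
    · simpa only [ExpeditionState.next, hh] using h
    · simp only [ExpeditionState.next, hh]
      have hp := portion_mem conv (start + s.time)
      refine ⟨hp.1, hp.2, h.3, h.4, h.5, ?_⟩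
      have h6 := h.time_le_cole
      have h7 := h.opened_nonneg
      rcases hC : s.partC with _ | ⟨t, n⟩
      · by_cases h0 : o * SignType.sign s.pos = -1
        · right
          simp only [h0, if_true, cole]
          push_cast
          linarith [hp.2]
        · left
          simp [h0]
      · right
        simp only [hC, cole, reduceCtorEq, false_or] at h6 ⊢
        push_cast
        linarith [hp.2]

/-- Every box unsealed in part C is charged a full day, which is at least what is walked on it.
Bounds for the time are therefore bounds for the charge. -/
theorem Bounded.time_le (h : s.Bounded) : s.time ≤ s.cole := by
  rcases h.time_le_cole with h1 | h1
  · rw [cole, h1]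
  · linarith [h.opened_nonneg]

theorem run_cons (plan : List ExpeditionAction) :
    s.run conv start (a :: plan) = (s.next conv start a).run conv start plan := rfl

/-- A property that is preserved by all allowed actions holds at the end of a plan. -/
theorem run_induction {I : ExpeditionState → Prop}
    (hI : ∀ s a, I s → s.Allows a → I (s.next conv start a)) :
    ∀ (plan : List ExpeditionAction) (s : ExpeditionState), I s → s.Feasible conv start plan →
      I (s.run conv start plan)
  | [], _, h, _ => h
  | a :: plan, s, h, hf => run_induction hI plan (s.next conv start a) (hI s a h hf.1) hf.2

end ExpeditionState

/-! ### Excursions: boxes at twice their distance -/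

/-- Potential of a walker who moves out. -/
noncomputable def reachPotential (x r : ℝ) : ℝ := reachCost (x + r) - min x (5 - x)

/-- Potential of a walker who has to return. -/
noncomputable def returnPotential (x r : ℝ) : ℝ := -reachCost (x - r + 1) - min x (5 - x)

theorem abs_min_sub_min_le (x y : ℝ) : |min y (5 - y) - min x (5 - x)| ≤ |y - x| := by
  grind

/-- The sum of distance and ration never grows. Besides that only `-min x (5 - x)` varies, or `+min
x (5 - x)` with a box in hand, and both change by at most the distance walked; the last term of the
potential serves this purpose. -/
theorem reachPotential_walkLaw {V : ℝ → ℝ} (hV : V = 0 ∨ V = fun x => 2 * min x (5 - x)) :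
    WalkLaw reachPotential V 0 5 := by
  intro x y r hx hx' hy hy' hr hr1
  have h1 : reachCost (y + (r - |y - x|)) ≤ reachCost (x + r) :=
    reachCost_mono (by linarith [le_abs_self (y - x)])
  have h2 := abs_le.1 (abs_min_sub_min_le x y)
  unfold reachPotential
  rcases hV with rfl | rfl <;> simp only [Pi.zero_apply] <;> linarith

theorem returnPotential_walkLaw {V : ℝ → ℝ} (hV : V = 0 ∨ V = fun x => 2 * min x (5 - x)) :
    WalkLaw returnPotential V 0 5 := by
  intro x y r hx hx' hy hy' hr hr1
  have h1 : reachCost (x - r + 1) ≤ reachCost (y - (r - |y - x|) + 1) :=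
    reachCost_mono (by linarith [neg_le_abs (y - x)])
  have h2 := abs_le.1 (abs_min_sub_min_le x y)
  unfold returnPotential
  rcases hV with rfl | rfl <;> simp only [Pi.zero_apply] <;> linarith

theorem reachPotential_unpackLaw :
    UnpackLaw reachPotential (fun x => 2 * min x (5 - x)) 0 5 := by
  intro x r r' hx hx' h0 h1 h0' h1'
  have h2 := reachCost_add_one hx hx'
  have h3 : reachCost (x + r') ≤ reachCost (x + 1) := reachCost_mono (by linarith)
  have h4 : reachCost x ≤ reachCost (x + r) := reachCost_mono (by linarith)
  simp only [reachPotential]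
  linarith

theorem returnPotential_unpackLaw :
    UnpackLaw returnPotential (fun x => 2 * min x (5 - x)) 0 5 := by
  intro x r r' hx hx' h0 h1 h0' h1'
  have h2 := reachCost_add_one hx hx'
  have h3 : reachCost x ≤ reachCost (x - r' + 1) := reachCost_mono (by linarith)
  have h4 : reachCost (x - r + 1) ≤ reachCost (x + 1) := reachCost_mono (by linarith)
  simp only [returnPotential]
  linarith

/-- Twice the distance of a place from the base. -/
noncomputable def double (_ : SignType) (p : AddCircle (5 : ℝ)) : ℝ :=
  2 * min (ahead p) (5 - ahead p)

theorem double_zero (o : SignType) : double o 0 = 0 := by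
  norm_num [double, ahead_zero]

theorem min_ahead_coe {x : ℝ} (h : -5 ≤ x) (h' : x ≤ 5) :
    min (ahead (x : AddCircle (5 : ℝ))) (5 - ahead (x : AddCircle (5 : ℝ))) =
      min |x| (5 - |x|) := by
  rcases lt_or_ge x 0 with h0 | h0
  · rw [ahead_coe_neg h h0, abs_of_neg h0, min_comm]
    congr 1 <;> ring
  · rcases eq_or_lt_of_le h' with h5 | h5
    · rw [h5, coe_five, ahead_zero]
      norm_num
    · rw [ahead_coe h0 h5, abs_of_nonneg h0]

theorem abs_sub_abs_of_same_side {x y : ℝ}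
    (h : (0 ≤ x ∧ 0 ≤ y ∧ y ≤ 5) ∨ (x ≤ 0 ∧ y ≤ 0 ∧ -5 ≤ y)) :
    |(|y| - |x|)| = |y - x| := by
  rcases h with ⟨h1, h2, -⟩ | ⟨h1, h2, -⟩
  · rw [abs_of_nonneg h1, abs_of_nonneg h2]
  · rw [abs_of_nonpos h1, abs_of_nonpos h2, abs_sub_comm]
    congr 1
    ring

namespace ExpeditionState

variable {conv : Convention} {start : ℝ} {s : ExpeditionState} {a : ExpeditionAction}

/-- Slack for boxes that are worth twice their distance from the base. -/
theorem slack_double_next {P : ℝ → ℝ → ℝ} (hP : WalkLaw P 0 0 5)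
    (hP' : WalkLaw P (fun x => 2 * min x (5 - x)) 0 5)
    (hPu : UnpackLaw P (fun x => 2 * min x (5 - x)) 0 5)
    (h : s.Bounded) (ha : s.Allows a) :
    slack double (fun x => P |x|) s ≤ slack double (fun x => P |x|) (s.next conv start a) := by
  have hx := abs_le.2 ⟨h.le_pos, h.pos_le⟩
  cases a with
  | walk y =>
    rw [slack_walk double_zero]
    obtain ⟨-, h1, h2⟩ := ha
    have hy : -5 ≤ y ∧ y ≤ 5 := by
      rcases h2 with ⟨_, _, _⟩ | ⟨_, _, _⟩ <;> constructor <;> linarith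
    have h3 := abs_sub_abs_of_same_side h2
    rcases s.handAfter y with _ | o
    · have := hP _ _ _ (abs_nonneg s.pos) hx (abs_nonneg y) (abs_le.2 hy) (h3.trans_le h1)
        h.opened_le
      rw [h3] at this
      simp only [Pi.zero_apply, Option.elim] at this ⊢
      linarith
    · have := hP' _ _ _ (abs_nonneg s.pos) hx (abs_nonneg y) (abs_le.2 hy) (h3.trans_le h1)
        h.opened_le
      rw [h3] at this
      simp only [Option.elim, double, min_ahead_coe h.le_pos h.pos_le, min_ahead_coe hy.1 hy.2]
      linarith
  | take o => rw [slack_take double_zero _ ha]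
  | drop => rw [slack_drop]
  | unpack =>
    obtain ⟨o, ho⟩ := Option.ne_none_iff_exists'.1 ha.2
    rw [slack_unpack _ ho]
    have hp := portion_mem conv (start + s.time)
    have := hPu |s.pos| s.opened _ (abs_nonneg _) hx h.opened_nonneg h.opened_le hp.1 hp.2
    simp only [double, min_ahead_coe h.le_pos h.pos_le]
    linarith

/-- A lower bound for the time of a walker who moves out, `c` being spent before. -/
def Reach (c : ℝ) (s : ExpeditionState) : Prop :=
  c ≤ slack double (fun x => reachPotential |x|) s

/-- A lower bound for the time of a walker who has to return, at a total cost of `c`. -/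
def Return (c : ℝ) (s : ExpeditionState) : Prop :=
  c ≤ slack double (fun x => returnPotential |x|) s

theorem Reach.next {c : ℝ} (hc : s.Reach c) (h : s.Bounded) (ha : s.Allows a) :
    (s.next conv start a).Reach c :=
  le_trans hc (slack_double_next (reachPotential_walkLaw (Or.inl rfl))
    (reachPotential_walkLaw (Or.inr rfl)) reachPotential_unpackLaw h ha)

theorem Return.next {c : ℝ} (hc : s.Return c) (h : s.Bounded) (ha : s.Allows a) :
    (s.next conv start a).Return c :=
  le_trans hc (slack_double_next (returnPotential_walkLaw (Or.inl rfl))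
    (returnPotential_walkLaw (Or.inr rfl)) returnPotential_unpackLaw h ha)

/-- At any point the walker may be declared to be returning. The change of potential pays for the
excursion to that point, and `Return.reach` makes the gain final at the base, where both potentials
vanish. -/
theorem Reach.return {c : ℝ} (h : s.Bounded) (hc : s.Reach c) :
    s.Return (c + tripCost |s.pos|) := by
  have h1 := tripCost_le (abs_nonneg s.pos) h.opened_nonneg h.opened_le
  unfold Return Reach slack reachPotential returnPotential at *
  linarith

theorem Return.reach {c : ℝ} (h : s.Bounded) (hc : s.Return c) (h0 : s.pos = 0) : s.Reach c := by
  have h1 : reachCost (0 + s.opened) = 0 :=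
    reachCost_eq_zero (by linarith [h.opened_nonneg]) (by linarith [h.opened_le])
  have h2 : reachCost (0 - s.opened + 1) = 0 :=
    reachCost_eq_zero (by linarith [h.opened_le]) (by linarith [h.opened_nonneg])
  simp only [Return, Reach, slack, reachPotential, returnPotential, h0, abs_zero, h1, h2] at *
  linarith

theorem Return.mono {c c' : ℝ} (hc : s.Return c) (h : c' ≤ c) : s.Return c' := le_trans h hc

theorem Reach.mono {c c' : ℝ} (hc : s.Reach c) (h : c' ≤ c) : s.Reach c' := le_trans h hc

theorem stock_nonneg {v : SignType → AddCircle (5 : ℝ) → ℝ} (hv : ∀ o p, 0 ≤ v o p) :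
    0 ≤ stock v s := by
  refine add_nonneg (Multiset.sum_nonneg fun x hx => ?_) ?_
  · obtain ⟨b, -, rfl⟩ := Multiset.mem_map.1 hx
    exact hv _ _
  · cases s.hand <;> simp [hv]

theorem double_nonneg (o : SignType) (p : AddCircle (5 : ℝ)) : 0 ≤ double o p :=
  mul_nonneg zero_le_two (le_min (ahead_nonneg p) (by linarith [ahead_lt p]))

theorem Reach.le_time {c : ℝ} (hc : s.Reach c) (hp : |s.pos| = 5) (h : s.Bounded) :
    c + 12 ≤ s.time := by
  have h1 := stock_nonneg double_nonneg (s := s)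
  have h2 : reachCost (5 + s.opened) = 12 := reachCost_eq (by linarith [h.opened_nonneg])
  simp only [Reach, slack, reachPotential, hp, h2] at hc
  norm_num at hc
  linarith

theorem Reach.le_time_of_pos_eq_zero {c : ℝ} (hc : s.Reach c) (hp : s.pos = 0) (h : s.Bounded) :
    c ≤ s.time := by
  have h1 := stock_nonneg double_nonneg (s := s)
  have h2 : reachCost (0 + s.opened) = 0 :=
    reachCost_eq_zero (by linarith [h.opened_nonneg]) (by linarith [h.opened_le])
  simp only [Reach, slack, reachPotential, hp, abs_zero, h2] at hc
  norm_num at hc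
  linarith

theorem reach_initial : initial.Reach 0 := by
  simp [Reach, slack, stock, initial, reachPotential,
    reachCost_eq_zero (by norm_num : (-1 : ℝ) ≤ 0) (by norm_num)]

/-- The time spent when the visited points lie between `-q` and `p`. -/
def Covers (s : ExpeditionState) : Prop :=
  ∃ p q : ℝ, 0 ≤ p ∧ 0 ≤ q ∧ -q ≤ s.pos ∧ s.pos ≤ p ∧
    s.visited ⊆ (fun x : ℝ => (x : AddCircle (5 : ℝ))) '' Set.Icc (-q) p ∧
    s.Return (tripCost p + tripCost q) ∧ (0 ≤ s.pos → s.Reach (tripCost q)) ∧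
    (s.pos ≤ 0 → s.Reach (tripCost p))

theorem covers_initial : initial.Covers := by
  have h := reach_initial
  refine ⟨0, 0, le_rfl, le_rfl, by simp [initial], by simp [initial], by simp [initial], ?_, ?_, ?_⟩
  · simpa [tripCost_zero, initial] using h.return bounded_initial
  · exact fun _ => by simpa [tripCost_zero] using h
  · exact fun _ => by simpa [tripCost_zero] using h

theorem next_pos_of_ne_walk (ha : ∀ y, a ≠ .walk y) :
    (s.next conv start a).pos = s.pos ∧ (s.next conv start a).visited = s.visited := by
  cases a with
  | walk y => exact absurd rfl (ha y)
  | take o => by_cases h0 : s.place = 0 <;> simp [next, h0]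
  | drop => rcases hh : s.hand with _ | o <;> simp [next, hh]
  | unpack => rcases hh : s.hand with _ | o <;> simp [next, hh]

/-- Only the furthest excursion on each side is counted. On one side `Reach` holds with the cost of
the other side, so a new record there replaces the old excursion on that side through
`Reach.return`. -/
theorem Covers.next (hc : s.Covers) (h : s.Bounded) (ha : s.Allows a) :
    (s.next conv start a).Covers := by
  obtain ⟨p, q, hp, hq, h1, h2, h3, h4, h5, h6⟩ := hc
  have hn := h.next (conv := conv) (start := start) ha
  by_cases hw : ∀ y, a ≠ .walk y
  · obtain ⟨e1, e2⟩ := next_pos_of_ne_walk (conv := conv) (start := start) (s := s) hw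
    refine ⟨p, q, hp, hq, ?_, ?_, ?_, h4.next h ha, ?_, ?_⟩
    · rwa [e1]
    · rwa [e1]
    · rwa [e2]
    · rw [e1]
      exact fun h0 => (h5 h0).next h ha
    · rw [e1]
      exact fun h0 => (h6 h0).next h ha
  push Not at hw
  obtain ⟨y, rfl⟩ := hw
  obtain ⟨-, ha1, ha2⟩ := id ha
  have hv : (s.next conv start (.walk y)).visited ⊆
      (fun x : ℝ => (x : AddCircle (5 : ℝ))) '' Set.Icc (-max q (-y)) (max p y) := by
    refine Set.union_subset (h3.trans (Set.image_mono ?_)) (Set.image_mono ?_)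
    · exact Set.Icc_subset_Icc (neg_le_neg (le_max_left _ _)) (le_max_left _ _)
    · intro t ht
      have h7 := Set.mem_uIcc.1 ht
      have := le_max_left q (-y)
      have := le_max_right q (-y)
      have := le_max_left p y
      have := le_max_right p y
      constructor <;> rcases h7 with h7 | h7 <;> linarith
  have h4' := h4.next (conv := conv) (start := start) h ha
  have hpos : (s.next conv start (.walk y)).pos = y := rfl
  refine ⟨max p y, max q (-y), hp.trans (le_max_left _ _), hq.trans (le_max_left _ _), ?_, ?_, hv,
    ?_⟩
  · rw [hpos]
    linarith [le_max_right q (-y)]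
  · exact le_max_right _ _
  rw [hpos]
  rcases ha2 with ⟨h0, h0', -⟩ | ⟨h0, h0', -⟩
  · rw [max_eq_left (by linarith : -y ≤ q)]
    have h5' := (h5 h0).next (conv := conv) (start := start) h ha
    have hR : (s.next conv start (.walk y)).Return (tripCost (max p y) + tripCost q) := by
      rcases le_total y p with hy | hy
      · rwa [max_eq_left hy]
      · have := h5'.return hn
        rwa [hpos, abs_of_nonneg h0', add_comm, ← congrArg tripCost (max_eq_right hy)] at this
    refine ⟨hR, fun _ => h5', fun hy0 => (hR.mono ?_).reach hn (le_antisymm hy0 h0')⟩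
    linarith [tripCost_nonneg hq]
  · rw [max_eq_left (by linarith : y ≤ p)]
    have h6' := (h6 h0).next (conv := conv) (start := start) h ha
    have hR : (s.next conv start (.walk y)).Return (tripCost p + tripCost (max q (-y))) := by
      rcases le_total (-y) q with hy | hy
      · rwa [max_eq_left hy]
      · have := h6'.return hn
        rwa [hpos, abs_of_nonpos h0', ← congrArg tripCost (max_eq_right hy)] at this
    refine ⟨hR, fun hy0 => (hR.mono ?_).reach hn (le_antisymm h0' hy0), fun _ => h6'⟩
    linarith [tripCost_nonneg hp]

theorem five_le_of_univ_subset {p q : ℝ} (hp : 0 ≤ p) (hq : 0 ≤ q)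
    (h : Set.univ ⊆ (fun x : ℝ => (x : AddCircle (5 : ℝ))) '' Set.Icc (-q) p) : 5 ≤ p + q := by
  by_contra! hlt
  -- The midpoint of the unvisited gap between `p` and `5 - q`.
  obtain ⟨x, hx, hxe⟩ := h (Set.mem_univ (((p + (5 - q)) / 2 : ℝ) : AddCircle (5 : ℝ)))
  have h1 := congrArg ahead hxe
  dsimp only at h1
  rw [ahead_coe (x := (p + (5 - q)) / 2) (by linarith) (by linarith)] at h1
  rcases lt_or_ge x 0 with h0 | h0
  · rw [ahead_coe_neg (by linarith [hx.1]) h0] at h1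
    linarith [hx.1]
  · rw [ahead_coe h0 (by linarith [hx.2])] at h1
    linarith [hx.2]

/-- Without going around, the circuit takes at least 24 days. -/
theorem Covers.le_time (hc : s.Covers) (h : s.Bounded) (hs : s.visited = Set.univ)
    (h0 : s.pos = 0) : 24 ≤ s.time := by
  obtain ⟨p, q, hp, hq, -, -, h3, h4, -, -⟩ := hc
  have h5 := le_tripCost_add hp hq (five_le_of_univ_subset hp hq (hs ▸ h3))
  exact ((h4.reach h h0).mono h5).le_time_of_pos_eq_zero h0 h

end ExpeditionState

/-! ### Slack before a box from the far side is unsealed -/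

namespace Scheme

variable (S : Scheme)

/-- The price of a box of origin `o` at the place `p`. -/
noncomputable def price (o : SignType) (p : AddCircle (5 : ℝ)) : ℝ :=
  if ahead p = 0 then 0 else if o = -1 then S.priceFar (5 - ahead p) else S.priceOut (ahead p)

theorem price_zero (o : SignType) : S.price o 0 = 0 := by simp [price, ahead_zero]

theorem price_nonneg (o : SignType) (p : AddCircle (5 : ℝ)) : 0 ≤ S.price o p := by
  unfold price
  split_ifs
  · rfl
  · exact S.priceFar_nonneg (by linarith [ahead_lt p])
  · exact S.priceOut_nonneg (ahead_nonneg p)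

theorem price_coe_neg_one {x : ℝ} (h : 0 < x) (h' : x < 5) :
    S.price (-1) x = S.priceFar (5 - x) := by
  simp [price, ahead_coe h.le h', h.ne']

theorem price_coe_neg_one_le {x : ℝ} (h : 0 ≤ x) (h' : x ≤ 5) :
    S.price (-1) x ≤ S.priceFar (5 - x) := by
  rcases eq_or_lt_of_le h with h0 | h0
  · rw [← h0, AddCircle.coe_zero, price_zero]
    exact S.priceFar_nonneg (by norm_num)
  rcases eq_or_lt_of_le h' with h5 | h5
  · rw [h5, coe_five, price_zero]
    exact S.priceFar_nonneg (by norm_num)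
  · exact (S.price_coe_neg_one h0 h5).le

theorem price_coe {o : SignType} (ho : o ≠ -1) {x : ℝ} (h : 0 ≤ x) (h' : x < 5) :
    S.price o x = S.priceOut x := by
  rcases eq_or_lt_of_le h with h0 | h0
  · rw [← h0, AddCircle.coe_zero, price_zero, S.priceOut_zero]
  · simp [price, ahead_coe h h', h0.ne', ho]

theorem price_coe_le {o : SignType} (ho : o ≠ -1) {x : ℝ} (h : 0 ≤ x) (h' : x ≤ 5) :
    S.price o x ≤ S.priceOut x := by
  rcases eq_or_lt_of_le h' with h5 | h5
  · rw [h5, coe_five, price_zero]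
    exact S.priceOut_nonneg (by norm_num)
  · exact (S.price_coe ho h h5).le

theorem price_far_neg_one {x : ℝ} (h : -5 < x) (h' : x ≤ 0) :
    S.price (-1) x = S.priceFar (-x) := by
  rcases eq_or_lt_of_le h' with h0 | h0
  · rw [h0, AddCircle.coe_zero, price_zero, neg_zero, S.priceFar_zero]
  · rw [price, ahead_coe_neg h.le h0, if_neg (by linarith), if_pos rfl]
    congr 1
    ring

theorem price_far {o : SignType} (ho : o ≠ -1) {x : ℝ} (h : -(5/2) ≤ x) (h' : x < 0) :
    S.price o x = S.priceOut 5 := by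
  rw [price, ahead_coe_neg (by linarith) h', if_neg (by linarith), if_neg ho]
  exact S.priceOut_const _ (by linarith)

theorem price_far_le {o : SignType} (ho : o ≠ -1) {x : ℝ} (h : -(5/2) ≤ x) (h' : x ≤ 0) :
    S.price o x ≤ S.priceOut 5 := by
  rcases eq_or_lt_of_le h' with h0 | h0
  · rw [h0, AddCircle.coe_zero, price_zero]
    exact S.priceOut_nonneg (by norm_num)
  · exact (S.price_far ho h h0).le

/-- The potential of a walker before a box from the far side is opened. -/
noncomputable def potential (x r : ℝ) : ℝ := if 0 ≤ x then S.out x r else S.far (-x) r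

/-- The same if a box has been left on the far side. -/
noncomputable def potential' (x r : ℝ) : ℝ := if 0 ≤ x then S.out x r else S.back (-x) r

end Scheme

namespace ExpeditionState

variable {conv : Convention} {start : ℝ} {s : ExpeditionState} {a : ExpeditionAction}
  (S : Scheme)

theorem slack_out_walk {P : ℝ → ℝ → ℝ} (hP : ∀ x r, 0 ≤ x → P x r = S.out x r) {y : ℝ}
    (h : s.Bounded) (ha : |y - s.pos| ≤ s.opened) (hx : 0 ≤ s.pos) (hx' : s.pos < 5)
    (hy : 0 ≤ y) (hy' : y ≤ 5) :
    slack S.price P s ≤ slack S.price P (s.next conv start (.walk y)) := by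
  rw [slack_walk S.price_zero, hP _ _ hx, hP _ _ hy]
  rcases ho : s.handAfter y with _ | o
  · have := S.walk_out _ _ _ hx h.pos_le hy hy' ha h.opened_le
    simp only [Pi.zero_apply, Option.elim] at this ⊢
    linarith
  simp only [Option.elim]
  by_cases h1 : o = -1
  · subst h1
    -- A box leaving the base in the positive direction is labelled with that direction, so a far
    -- box in hand shows that the walk does not start at the base.
    have hx0 : 0 < s.pos := by
      refine lt_of_le_of_ne hx fun h0 => ?_
      rw [handAfter_of_eq h0.symm] at ho
      obtain ⟨-, -, ho⟩ := Option.map_eq_some_iff.1 ho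
      rcases eq_or_lt_of_le hy with hy0 | hy0
      · simp [← hy0] at ho
      · simp [sign_pos hy0] at ho
    have := S.walk_priceFar _ _ _ hx h.pos_le hy hy' ha h.opened_le
    have := S.price_coe_neg_one_le hy hy'
    rw [S.price_coe_neg_one hx0 hx']
    linarith
  · have := S.walk_priceOut _ _ _ hx h.pos_le hy hy' ha h.opened_le
    have := S.price_coe_le h1 hy hy'
    rw [S.price_coe h1 hx hx']
    linarith

theorem slack_far_walk {P Q : ℝ → ℝ → ℝ}
    (hP : ∀ x r, x ≤ 0 → 0 ≤ r → r ≤ 1 → P x r = Q (-x) r)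
    (hQ : WalkLaw Q 0 0 (5/2)) (hQ' : WalkLaw Q S.priceFar 0 (5/2)) {y : ℝ}
    (h : s.Bounded) (ha : |y - s.pos| ≤ s.opened) (hx : s.pos ≤ 0) (hx' : -(5/2) ≤ s.pos)
    (hy : y ≤ 0) (hy' : -(5/2) ≤ y) :
    slack S.price P s ≤ slack S.price P (s.next conv start (.walk y)) := by
  have h3 : |(-y) - (-s.pos)| = |y - s.pos| := by
    rw [← abs_neg]
    congr 1
    ring
  have h0 := hQ (-s.pos) (-y) s.opened (by linarith) (by linarith) (by linarith) (by linarith)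
    (h3.trans_le ha) h.opened_le
  have h0' := hQ' (-s.pos) (-y) s.opened (by linarith) (by linarith) (by linarith) (by linarith)
    (h3.trans_le ha) h.opened_le
  rw [h3] at h0 h0'
  rw [slack_walk S.price_zero, hP _ _ hx h.opened_nonneg h.opened_le,
    hP _ _ hy (sub_nonneg.2 ha) (by linarith [h.opened_le, abs_nonneg (y - s.pos)])]
  simp only [Pi.zero_apply] at h0
  rcases ho : s.handAfter y with _ | o
  · simp only [Option.elim]
    linarith
  simp only [Option.elim]
  by_cases h1 : o = -1
  · subst h1
    rw [S.price_far_neg_one (by linarith) hx, S.price_far_neg_one (by linarith) hy]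
    linarith
  rcases eq_or_lt_of_le hx with hx0 | hx0
  · rw [handAfter_of_eq hx0] at ho
    obtain ⟨-, -, ho⟩ := Option.map_eq_some_iff.1 ho
    rcases eq_or_lt_of_le hy with hy0 | hy0
    · have : S.price o y = S.price o s.pos := by rw [hx0, hy0]
      linarith
    · exact absurd (ho.symm.trans (sign_neg hy0)) h1
  · have := S.price_far_le h1 hy' hy
    rw [S.price_far h1 hx' hx0]
    linarith

theorem slack_out_unpack {P : ℝ → ℝ → ℝ} (hP : ∀ x r, 0 ≤ x → P x r = S.out x r)
    {o : SignType} (ho : s.hand = some o) (ho' : o = -1 → s.pos = 0) (h : s.Bounded)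
    (hx : 0 ≤ s.pos) (hx' : s.pos < 5) :
    slack S.price P s ≤ slack S.price P (s.next conv start .unpack) := by
  have hp := portion_mem conv (start + s.time)
  rw [slack_unpack _ ho, hP _ _ hx, hP _ _ hx]
  have h1 := S.unpackLaw _ _ _ hx h.pos_le h.opened_nonneg h.opened_le hp.1 hp.2
  by_cases h2 : o = -1
  · rw [ho' h2, AddCircle.coe_zero, S.price_zero]
    rw [ho' h2, S.priceOut_zero] at h1
    linarith
  · rw [S.price_coe h2 hx hx']
    linarith

theorem slack_far_unpack {P Q : ℝ → ℝ → ℝ}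
    (hP : ∀ x r, x ≤ 0 → 0 ≤ r → r ≤ 1 → P x r = Q (-x) r)
    (hQ : UnpackLaw Q S.priceFar 0 (5/2)) {o : SignType} (ho : s.hand = some o) (h : s.Bounded)
    (hx : s.pos ≤ 0) (hx' : -(5/2) ≤ s.pos) :
    slack S.price P s ≤ slack S.price P (s.next conv start .unpack) := by
  have hp := portion_mem conv (start + s.time)
  rw [slack_unpack _ ho, hP _ _ hx h.opened_nonneg h.opened_le, hP _ _ hx hp.1 hp.2]
  have h1 := hQ (-s.pos) _ _ (by linarith) (by linarith) h.opened_nonneg h.opened_le hp.1 hp.2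
  by_cases h2 : o = -1
  · rw [h2, S.price_far_neg_one (by linarith) hx]
    linarith
  rcases eq_or_lt_of_le hx with hx0 | hx0
  · rw [hx0, AddCircle.coe_zero, S.price_zero]
    rw [hx0, neg_zero, S.priceFar_zero] at h1
    rw [neg_zero]
    linarith
  · rw [S.price_far h2 hx' hx0]
    -- A box carried round from the near side keeps the price `priceOut 5`, which exceeds every far
    -- price.
    linarith [S.priceFar_le (-s.pos)]

theorem potential_of_nonneg (x r : ℝ) (hx : 0 ≤ x) : S.potential x r = S.out x r := if_pos hx

theorem potential'_of_nonneg (x r : ℝ) (hx : 0 ≤ x) : S.potential' x r = S.out x r := if_pos hx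

theorem potential_of_nonpos (x r : ℝ) (hx : x ≤ 0) (h : 0 ≤ r) (h' : r ≤ 1) :
    S.potential x r = S.far (-x) r := by
  rcases eq_or_lt_of_le hx with h0 | h0
  · rw [potential_of_nonneg _ _ _ h0.ge, h0, neg_zero, S.out_zero r h h', S.far_zero r h h']
  · exact if_neg h0.not_ge

theorem potential'_of_nonpos (x r : ℝ) (hx : x ≤ 0) (h : 0 ≤ r) (h' : r ≤ 1) :
    S.potential' x r = S.back (-x) r := by
  rcases eq_or_lt_of_le hx with h0 | h0
  · rw [potential'_of_nonneg _ _ _ h0.ge, h0, neg_zero, S.out_zero r h h', S.back_zero r h h']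
  · exact if_neg h0.not_ge

/-- Slack is not lost as long as no box from the far side is opened on the way out. -/
theorem slack_potential_next (h : s.Bounded) (ha : s.Allows a) (hx : -(5/2) ≤ s.pos)
    (hx' : -(5/2) ≤ (s.next conv start a).pos)
    (hu : a = .unpack → s.hand = some (-1) → s.pos ≤ 0) :
    slack S.price S.potential s ≤ slack S.price S.potential (s.next conv start a) ∧
      slack S.price S.potential' s ≤ slack S.price S.potential' (s.next conv start a) := by
  have hlt := abs_lt.1 (h.abs_pos_lt ha)
  cases a with
  | walk y =>
    obtain ⟨-, h1, h2⟩ := ha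
    rcases h2 with ⟨h2, h3, h4⟩ | ⟨h2, h3, h4⟩
    · exact ⟨slack_out_walk S (potential_of_nonneg S) h h1 h2 hlt.2 h3 h4,
        slack_out_walk S (potential'_of_nonneg S) h h1 h2 hlt.2 h3 h4⟩
    · exact ⟨slack_far_walk S (potential_of_nonpos S) S.far_walk S.far_walk_price h h1 h2 hx h3 hx',
        slack_far_walk S (potential'_of_nonpos S) S.back_walk S.back_walk_price h h1 h2 hx h3 hx'⟩
  | take o => exact ⟨(slack_take S.price_zero _ ha).ge, (slack_take S.price_zero _ ha).ge⟩
  | drop => exact ⟨(slack_drop _).ge, (slack_drop _).ge⟩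
  | unpack =>
    obtain ⟨o, ho⟩ := Option.ne_none_iff_exists'.1 ha.2
    rcases le_total 0 s.pos with h0 | h0
    · have ho' : o = -1 → s.pos = 0 := fun h1 => le_antisymm (hu rfl (h1 ▸ ho)) h0
      exact ⟨slack_out_unpack S (potential_of_nonneg S) ho ho' h h0 hlt.2,
        slack_out_unpack S (potential'_of_nonneg S) ho ho' h h0 hlt.2⟩
    · exact ⟨slack_far_unpack S (potential_of_nonpos S) S.far_unpackLaw ho h h0 hx,
        slack_far_unpack S (potential'_of_nonpos S) S.back_unpackLaw ho h h0 hx⟩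

/-- What a box from the far side is worth beyond its price. -/
noncomputable def _root_.Scheme.bonus (S : Scheme) (z : ℝ) : ℝ :=
  S.worth (5 - z) - S.priceFar (5 - z)

/-- The lower bounds for the time before a box from the far side is opened. -/
structure Prepared (s : ExpeditionState) : Prop where
  slack_nonneg : 0 ≤ slack S.price S.potential s
  ground : ∀ p, (-1, p) ∈ s.ground → p ≠ 0 → S.bonus (ahead p) ≤ slack S.price S.potential' s
  hand : s.hand = some (-1) → 0 < s.pos → S.bonus s.pos ≤ slack S.price S.potential' s

theorem prepared_initial : initial.Prepared S where
  slack_nonneg := by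
    simp [slack, stock, initial, potential_of_nonneg, S.out_zero 0 le_rfl zero_le_one]
  ground := by simp [initial]
  hand := by simp [initial]

/-- A far box carried on the near side can be valued by `worth` instead of `priceFar`, because
`worth` also satisfies the walking law. -/
theorem bonus_walk {y : ℝ} (h : s.Bounded) (ha : |y - s.pos| ≤ s.opened) (hx : 0 ≤ s.pos)
    (hx' : s.pos < 5) (hy : 0 < y) (hy' : y ≤ 5) (ho : s.handAfter y = some (-1))
    (hb : s.hand = some (-1) → 0 < s.pos → S.bonus s.pos ≤ slack S.price S.potential' s) :
    S.bonus y ≤ slack S.price S.potential' (s.next conv start (.walk y)) := by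
  have hx0 : 0 < s.pos := by
    refine lt_of_le_of_ne hx fun h0 => ?_
    rw [handAfter_of_eq h0.symm] at ho
    obtain ⟨-, -, ho⟩ := Option.map_eq_some_iff.1 ho
    simp [sign_pos hy] at ho
  have hs := hb (by rwa [handAfter_of_ne hx0.ne'] at ho) hx0
  have := S.walk_worth _ _ _ hx h.pos_le hy.le hy' ha h.opened_le
  have := S.price_coe_neg_one_le hy.le hy'
  rw [slack_walk S.price_zero, ho, potential'_of_nonneg S _ _ hx, potential'_of_nonneg S _ _ hy.le]
  simp only [Option.elim, S.price_coe_neg_one hx0 hx', Scheme.bonus] at hs ⊢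
  linarith

/-- The slack must cover the bonus of each far box separately, not of all together, since only the
first one unsealed is credited. A bonus arises when a box is dropped on the far side; afterwards the
slack with `potential'` does not decrease. -/
theorem Prepared.next {S : Scheme} (hs : s.Prepared S) (h : s.Bounded) (ha : s.Allows a)
    (hx : -(5/2) ≤ s.pos) (hx' : -(5/2) ≤ (s.next conv start a).pos)
    (hu : a = .unpack → s.hand = some (-1) → s.pos ≤ 0) :
    (s.next conv start a).Prepared S := by
  obtain ⟨h1, h2⟩ := slack_potential_next S h ha hx hx' hu
  have hlt := abs_lt.1 (h.abs_pos_lt ha)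
  refine ⟨hs.slack_nonneg.trans h1, fun p hp hp0 => ?_, fun hh hpos => ?_⟩
  · by_cases hg : (-1, p) ∈ s.ground
    · exact (hs.ground p hg hp0).trans h2
    cases a with
    | walk y => exact absurd hp hg
    | take o =>
      by_cases h0 : s.place = 0
      · exact absurd (by simpa [ExpeditionState.next, h0] using hp) hg
      · simp only [ExpeditionState.next, h0, if_false] at hp
        exact absurd (Multiset.mem_of_mem_erase hp) hg
    | unpack =>
      rcases ho : s.hand with _ | o <;>
        exact absurd (by simpa [ExpeditionState.next, ho] using hp) hg
    | drop =>
      obtain ⟨o, ho⟩ := Option.ne_none_iff_exists'.1 ha.2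
      have hp' : (-1, p) ∈ (o, s.place) ::ₘ s.ground := by
        simpa only [ExpeditionState.next, ho] using hp
      have hop := (Multiset.mem_cons.1 hp').resolve_right hg
      obtain ⟨rfl, rfl⟩ := Prod.mk.inj hop
      have hpos0 : s.pos ≠ 0 := fun h0 => hp0 ((h.place_eq_zero ha).2 h0)
      rw [slack_drop]
      rcases lt_or_gt_of_ne hpos0 with hneg | hpos
      -- Replacing `far` by `back` at the moment of dropping turns nonnegative slack into slack of
      -- at least the bonus.
      · have h3 := S.drop (-s.pos) s.opened (by linarith) (by linarith) h.opened_nonneg h.opened_le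
        have h4 := hs.slack_nonneg
        rw [slack, potential_of_nonpos S _ _ hneg.le h.opened_nonneg h.opened_le] at h4
        rw [slack, potential'_of_nonpos S _ _ hneg.le h.opened_nonneg h.opened_le, place,
          ahead_coe_neg h.le_pos hneg, Scheme.bonus, show 5 - (5 + s.pos) = -s.pos by ring]
        linarith
      · rw [place, ahead_coe hpos.le hlt.2]
        exact hs.hand ho hpos
  · cases a with
    | walk y =>
      obtain ⟨-, h3, h4⟩ := ha
      have hy : 0 < y := hpos
      rcases h4 with ⟨h5, h6, h7⟩ | ⟨h5, h6, h7⟩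
      · exact bonus_walk S h h3 h5 hlt.2 hy h7 hh hs.hand
      · linarith
    | take o =>
      by_cases h0 : s.place = 0
      · simp [ExpeditionState.next, h0] at hh
      · have hg := ha.2.2.resolve_left h0
        simp only [ExpeditionState.next, h0, if_false, Option.some.injEq] at hh hpos
        subst hh
        have := hs.ground _ hg h0
        rw [place, ahead_coe hpos.le hlt.2] at this
        have h6 : (s.next conv start (.take (-1))).pos = s.pos := by
          simp [ExpeditionState.next, h0]
        rw [h6]
        exact this.trans h2
    | drop =>
      obtain ⟨o, ho⟩ := Option.ne_none_iff_exists'.1 ha.2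
      simp [ExpeditionState.next, ho] at hh
    | unpack =>
      obtain ⟨o, ho⟩ := Option.ne_none_iff_exists'.1 ha.2
      simp [ExpeditionState.next, ho] at hh

/-- The time at which a box from the far side is opened on the way out. -/
theorem Prepared.le_time {S : Scheme} (hs : s.Prepared S) (ho : s.hand = some (-1))
    (hx : 0 < s.pos) (hx' : s.pos < 5) :
    S.out s.pos s.opened + S.worth (5 - s.pos) +
      (s.ground.map fun b => S.price b.1 b.2).sum ≤ s.time := by
  have := hs.hand ho hx
  simp only [Scheme.bonus, slack, stock, ho, Option.elim, place, S.price_coe_neg_one hx hx',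
    potential'_of_nonneg S _ _ hx.le] at this
  linarith

end ExpeditionState

/-! ### After a box from the far side is unsealed -/

theorem cheap_five {c : ℝ} (hc : 0 ≤ c) : cheap c 5 = 0 := by
  rw [cheap, sub_self]
  norm_num [hc]

theorem cheap_zero {c : ℝ} (hc : 0 ≤ c) : cheap c 0 = 0 := by
  rw [cheap]
  norm_num [hc]

/-- The price of a box at a place, on the last part of the way. -/
noncomputable def cheapPrice (c : ℝ) (_ : SignType) (p : AddCircle (5 : ℝ)) : ℝ :=
  cheap c (ahead p)

theorem cheapPrice_zero {c : ℝ} (hc : 0 ≤ c) (o : SignType) : cheapPrice c o 0 = 0 := by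
  rw [cheapPrice, ahead_zero, cheap_zero hc]

theorem cheapPrice_coe {c : ℝ} (hc : 0 ≤ c) (o : SignType) {x : ℝ} (h : 0 ≤ x) (h' : x ≤ 5) :
    cheapPrice c o x = cheap c x := by
  rcases eq_or_lt_of_le h' with h5 | h5
  · rw [h5, coe_five, cheapPrice_zero hc, cheap_five hc]
  · rw [cheapPrice, ahead_coe h h5]

/-- When part C begins, the boxes still on the ground are revalued from the scheme's prices to the
cheap ones. This only weakens the lower bound for the time. -/
theorem cheapPrice_le (S : Scheme) {c : ℝ} (hc : 0 ≤ c) (hc' : c ≤ 2) (o : SignType)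
    (p : AddCircle (5 : ℝ)) : cheapPrice c o p ≤ S.price o p := by
  have h1 : cheapPrice c o p ≤ min (2 * min (ahead p) (5 - ahead p)) 2 :=
    min_le_min le_rfl hc'
  unfold Scheme.price
  split_ifs with h0 h2
  · rw [cheapPrice, h0, cheap_zero hc]
  · exact h1.trans (S.le_priceFar _ (ahead_nonneg p) (ahead_lt p).le)
  · exact h1.trans (S.le_priceOut _ (ahead_nonneg p) (ahead_lt p).le)

theorem cheap_eq {c x : ℝ} (h : c / 2 ≤ x) (h' : c / 2 ≤ 5 - x) : cheap c x = c :=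
  min_eq_right (by
    have := le_min h h'
    linarith)

namespace ExpeditionState

variable {conv : Convention} {start : ℝ} {s : ExpeditionState} {a : ExpeditionAction}

/-- At least the time `T` will be needed. -/
def Aft (T : ℝ) (s : ExpeditionState) : Prop := 0 ≤ slack (cheapPrice 2) (aft T) s

theorem next_pos_nonneg (h : 0 < s.pos) (ha : s.Allows a) : 0 ≤ (s.next conv start a).pos := by
  by_cases hw : ∀ y, a ≠ .walk y
  · rw [(next_pos_of_ne_walk hw).1]
    exact h.le
  · push Not at hw
    obtain ⟨y, rfl⟩ := hw
    rcases ha.2.2 with h1 | h1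
    · exact h1.2.1
    · linarith [h1.1]

theorem next_pos_nonpos (h : s.pos < 0) (ha : s.Allows a) : (s.next conv start a).pos ≤ 0 := by
  by_cases hw : ∀ y, a ≠ .walk y
  · rw [(next_pos_of_ne_walk hw).1]
    exact h.le
  · push Not at hw
    obtain ⟨y, rfl⟩ := hw
    rcases ha.2.2 with h1 | h1
    · linarith [h1.1]
    · exact h1.2.1

theorem Aft.next {T : ℝ} (hs : s.Aft T) (h : s.Bounded) (hpos : 0 < s.pos) (ha : s.Allows a) :
    (s.next conv start a).Aft T := by
  refine le_trans hs ?_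
  cases a with
  | walk y =>
    obtain ⟨-, h1, h2⟩ := ha
    have hy : 0 ≤ y ∧ y ≤ 5 := by
      rcases h2 with h2 | h2
      · exact h2.2
      · linarith [h2.1]
    rw [slack_walk (cheapPrice_zero zero_le_two)]
    rcases s.handAfter y with _ | o
    · have := (aft_outLaw_zero T).walkLaw (aft_inLaw_zero T) _ _ _ hpos.le h.pos_le hy.1 hy.2 h1
        h.opened_le
      simp only [Pi.zero_apply, Option.elim] at this ⊢
      linarith
    · have := (aft_outLaw T).walkLaw (aft_inLaw T) _ _ _ hpos.le h.pos_le hy.1 hy.2 h1 h.opened_le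
      simp only [Option.elim]
      rw [cheapPrice_coe zero_le_two _ hpos.le h.pos_le, cheapPrice_coe zero_le_two _ hy.1 hy.2]
      linarith
  | take o => exact (slack_take (cheapPrice_zero zero_le_two) _ ha).ge
  | drop => exact (slack_drop _).ge
  | unpack =>
    obtain ⟨o, ho⟩ := Option.ne_none_iff_exists'.1 ha.2
    have hp := portion_mem conv (start + s.time)
    have := aft_unpackLaw T _ _ _ hpos.le h.pos_le h.opened_nonneg h.opened_le hp.1 hp.2
    rw [slack_unpack _ ho, cheapPrice_coe zero_le_two _ hpos.le h.pos_le]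
    linarith

theorem Aft.le_time {T : ℝ} (hs : s.Aft T) (h : s.Bounded) (h5 : s.pos = 5) : T ≤ s.time := by
  have h1 : 0 ≤ stock (cheapPrice 2) s := stock_nonneg fun o p =>
    le_min (double_nonneg o p) zero_le_two
  have h2 := h.opened_nonneg
  have h3 : T ≤ _root_.aft T s.pos s.opened := by
    refine le_max_of_le_left ?_
    rw [h5, max_eq_left (by linarith)]
    linarith
  unfold Aft slack at hs
  linarith

/-- Only one box has been opened in part C, another one being needed, and the bound `185/8` for
the charge is sure. The number `c` is the price of a box within reach. -/
structure OneOpened (c z : ℝ) (s : ExpeditionState) : Prop where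
  pos_c : 0 < c
  le_z : c / 2 ≤ z
  z_le : z ≤ s.pos - s.opened
  opened_le : s.opened ≤ 5 - s.pos - c / 2
  bound : ∃ t, s.partC = some (t, 1) ∧ 185/8 - 2 - c + stock (cheapPrice c) s ≤ t

/-- The bound `185/8` for the charge is reached. -/
def Charged (s : ExpeditionState) : Prop := ∃ t n, s.partC = some (t, n) ∧ 185/8 ≤ t + (n : ℝ)

theorem Charged.next (hs : s.Charged) (ha : s.Allows a) (hp : 0 < (s.next conv start a).pos) :
    (s.next conv start a).Charged := by
  obtain ⟨t, n, h1, h2⟩ := hs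
  cases a with
  | walk y =>
    have hy : y ≠ 0 := hp.ne'
    exact ⟨t, n, by simpa [ExpeditionState.next, hy] using h1, h2⟩
  | take o =>
    refine ⟨t, n, ?_, h2⟩
    by_cases h0 : s.place = 0 <;> simpa [ExpeditionState.next, h0] using h1
  | drop =>
    refine ⟨t, n, ?_, h2⟩
    rcases ho : s.hand with _ | o <;> simpa [ExpeditionState.next, ho] using h1
  | unpack =>
    obtain ⟨o, ho⟩ := Option.ne_none_iff_exists'.1 ha.2
    refine ⟨t, n + 1, by simp [ExpeditionState.next, ho, h1], ?_⟩
    push_cast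
    linarith

/-- Within reach of the current ration the capped price is constantly `c`, so walking does not
change the stock bound. Unsealing a second box shows that the stock was at least `c`, which with a
count of 2 gives `185/8`. -/
theorem OneOpened.next {c z : ℝ} (hs : s.OneOpened c z) (h : s.Bounded) (ha : s.Allows a)
    (hp : 0 < (s.next conv start a).pos) :
    (s.next conv start a).OneOpened c z ∨ (s.next conv start a).Charged := by
  obtain ⟨hc, hz, hz', ho, t, ht, hb⟩ := hs
  have hr := h.opened_nonneg
  cases a with
  | walk y =>
    left
    have hy : 0 < y := hp
    have hpos : 0 ≤ s.pos := by linarith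
    have hd : |y - s.pos| ≤ s.opened := ha.2.1
    have hd1 := le_abs_self (y - s.pos)
    have hd2 := neg_le_abs (y - s.pos)
    refine ⟨hc, hz, ?_, ?_, t, by simpa [ExpeditionState.next, hy.ne'] using ht, ?_⟩
    · simp only [ExpeditionState.next]
      linarith
    · simp only [ExpeditionState.next]
      linarith
    · have h1 := slack_walk (conv := conv) (start := start) (s := s) (cheapPrice_zero hc.le)
        (fun _ _ => 0) y
      have h2 : (s.handAfter y).elim 0 (fun o => cheapPrice c o s.pos) =
          (s.handAfter y).elim 0 fun o => cheapPrice c o y := by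
        rcases s.handAfter y with _ | o
        · rfl
        · simp only [Option.elim]
          rw [cheapPrice_coe hc.le _ hpos h.pos_le, cheapPrice_coe hc.le _ hy.le (by linarith),
            cheap_eq, cheap_eq] <;> linarith
      rw [h2] at h1
      simp only [slack] at h1
      have h3 : (s.next conv start (.walk y)).time = s.time + |y - s.pos| := rfl
      linarith
  | take o =>
    left
    have h1 := stock_take (conv := conv) (start := start) (cheapPrice_zero hc.le) ha
    refine ⟨hc, hz, ?_, ?_, t, ?_, by rwa [h1]⟩ <;>
      by_cases h0 : s.place = 0 <;> simpa [ExpeditionState.next, h0]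
  | drop =>
    left
    have h1 := stock_drop (conv := conv) (start := start) (s := s) (v := cheapPrice c)
    refine ⟨hc, hz, ?_, ?_, t, ?_, by rwa [h1]⟩ <;>
      rcases hh : s.hand with _ | o <;> simpa [ExpeditionState.next, hh]
  | unpack =>
    right
    obtain ⟨o, hh⟩ := Option.ne_none_iff_exists'.1 ha.2
    refine ⟨t, 2, by simp [ExpeditionState.next, hh, ht], ?_⟩
    have h1 : 0 ≤ (s.ground.map fun b => cheapPrice c b.1 b.2).sum :=
      Multiset.sum_nonneg fun x hx => by
        obtain ⟨b, -, rfl⟩ := Multiset.mem_map.1 hx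
        exact le_min (double_nonneg b.1 b.2) hc.le
    rw [stock, hh] at hb
    simp only [Option.elim, place] at hb
    rw [cheapPrice_coe hc.le _ (by linarith) h.pos_le, cheap_eq (by linarith) (by linarith)] at hb
    push_cast
    linarith

/-- A box from the far side has been opened on the way out. -/
structure Late (s : ExpeditionState) : Prop where
  pos_pos : 0 < s.pos
  return_twelve : s.Return 12
  aft : s.Aft (361/16)
  charge : s.Aft (185/8) ∨ s.Charged ∨ ∃ c z, s.OneOpened c z

theorem Late.next (hs : s.Late) (h : s.Bounded) (ha : s.Allows a)
    (hp : 0 < (s.next conv start a).pos) : (s.next conv start a).Late where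
  pos_pos := hp
  return_twelve := hs.return_twelve.next h ha
  aft := hs.aft.next h hs.pos_pos ha
  charge := by
    rcases hs.charge with h1 | h1 | ⟨c, z, h1⟩
    · exact Or.inl (h1.next h hs.pos_pos ha)
    · exact Or.inr (Or.inl (h1.next ha hp))
    · rcases h1.next (conv := conv) (start := start) h ha hp with h2 | h2
      · exact Or.inr (Or.inr ⟨c, z, h2⟩)
      · exact Or.inr (Or.inl h2)

theorem Late.le (hs : s.Late) (h : s.Bounded) (h5 : s.pos = 5) :
    361/16 ≤ s.time ∧ 185/8 ≤ s.cole := by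
  refine ⟨hs.aft.le_time h h5, ?_⟩
  rcases hs.charge with h1 | ⟨t, n, h1, h2⟩ | ⟨c, z, h1⟩
  · exact (h1.le_time h h5).trans h.time_le
  · rwa [cole, h1]
  -- Impossible at the end: the reach of the one ration stops short of the base by at least `c / 2`.
  · linarith [h1.opened_le, h1.pos_c, h.opened_nonneg]

theorem sum_cheapPrice_le (S : Scheme) {c : ℝ} (hc : 0 ≤ c) (hc' : c ≤ 2)
    (g : Multiset (SignType × AddCircle (5 : ℝ))) :
    (g.map fun b => cheapPrice c b.1 b.2).sum ≤ (g.map fun b => S.price b.1 b.2).sum :=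
  Multiset.sum_map_le_sum_map _ _ fun b _ => cheapPrice_le S hc hc' b.1 b.2

/-- The place of unsealing decides the scheme: for the time the cut is at `57/16`; for the charge
the cases are up to 3, between 3 and 4, and from 4 on. -/
theorem Prepared.late (h16 : s.Prepared scheme16) (h14 : s.Prepared scheme14)
    (h6 : s.Prepared scheme6) (h : s.Bounded) (ho : s.hand = some (-1)) (hx : 0 < s.pos)
    (hx' : s.pos < 5) (hC : s.partC = none) (hR : (s.next conv start .unpack).Return 12) :
    (s.next conv start .unpack).Late := by
  have t16 := h16.le_time ho hx hx'
  have t14 := h14.le_time ho hx hx'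
  have t6 := h6.le_time ho hx hx'
  have c16 := sum_cheapPrice_le scheme16 zero_le_two le_rfl s.ground
  have c14 := sum_cheapPrice_le scheme14 zero_le_two le_rfl s.ground
  have hp := portion_mem conv (start + s.time)
  have hslack : ∀ T, (s.next conv start .unpack).Aft T ↔
      _root_.aft T s.pos (conv.portion (start + s.time)) +
        (s.ground.map fun b => cheapPrice 2 b.1 b.2).sum ≤ s.time := by
    intro T
    simp only [Aft, slack, stock, ExpeditionState.next, ho, Option.elim]
    constructor <;> intro h <;> linarith
  have hC' : (s.next conv start .unpack).partC = some (s.time, 1) := by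
    simp [ExpeditionState.next, ho, hC, sign_pos hx]
  have hpos : (s.next conv start .unpack).pos = s.pos := by simp [ExpeditionState.next, ho]
  have hop : (s.next conv start .unpack).opened = conv.portion (start + s.time) := by
    simp [ExpeditionState.next, ho]
  refine ⟨by rwa [hpos], hR, (hslack _).2 ?_, ?_⟩
  · rcases le_total (57/16) s.pos with h1 | h1
    · have := aft_le_scheme16 h1 hx'.le h.opened_nonneg h.opened_le hp.2
      linarith
    · have := aft_le_scheme14 hx.le h.opened_nonneg h.opened_le hp.2 (Or.inl ⟨rfl, h1⟩)
      linarith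
  rcases le_or_gt s.pos 3 with h3 | h3
  · left
    have := aft_le_scheme14 hx.le h.opened_nonneg h.opened_le hp.2 (Or.inr ⟨rfl, h3⟩)
    exact (hslack _).2 (by linarith)
  right
  rcases le_or_gt 4 s.pos with h4 | h4
  · left
    refine ⟨s.time, 1, hC', ?_⟩
    have h7 := le_scheme6 h4 hx'.le h.opened_nonneg h.opened_le
    have h8 : 0 ≤ (s.ground.map fun b => scheme6.price b.1 b.2).sum :=
      Multiset.sum_nonneg fun x hx => by
        obtain ⟨b, -, rfl⟩ := Multiset.mem_map.1 hx
        exact scheme6.price_nonneg _ _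
    push_cast
    linarith
  · right
    have h7 := le_scheme14 h3.le h4.le h.opened_nonneg h.opened_le
    have h8 := sum_cheapPrice_le scheme14 (c := 2 * (5 - s.pos - 1)) (by linarith) (by linarith)
      s.ground
    -- One ration reaches from `s.pos - 1` to `s.pos + 1`. Between 3 and 4 the upper end is the one
    -- nearer to the base, and `c` is twice its distance.
    refine ⟨2 * (5 - s.pos - 1), s.pos - 1, by linarith, by linarith, ?_, ?_, s.time, hC', ?_⟩
    · rw [hpos, hop]
      linarith
    · rw [hpos, hop]
      linarith
    · simp only [stock, ExpeditionState.next, ho, Option.elim]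
      linarith

/-! ### The invariant of all expeditions -/

/-- No box from the far side has been opened on the way out. -/
structure Early (s : ExpeditionState) : Prop where
  le_pos : -(5/2) ≤ s.pos
  partC : 0 ≤ s.pos → s.partC = none
  h16 : s.Prepared scheme16
  h14 : s.Prepared scheme14
  h6 : s.Prepared scheme6
  far : s.Return 12 ∨ (∀ p, (-1, p) ∈ s.ground → p ≠ 0 → 5/2 ≤ ahead p) ∧
    (s.hand = some (-1) → 0 < s.pos → 5/2 ≤ s.pos)

/-- An excursion to at least half the way has been made, or has to be made. -/
def Lost (s : ExpeditionState) : Prop := s.Reach 12 ∨ s.pos < 0 ∧ s.Return 12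

/-- The invariant of all expeditions. -/
def Invariant (s : ExpeditionState) : Prop :=
  s.Bounded ∧ s.Reach 0 ∧ (s.Lost ∨ s.Early ∨ s.Late)

theorem invariant_initial : initial.Invariant := by
  refine ⟨bounded_initial, reach_initial, Or.inr (Or.inl ⟨?_, fun _ => rfl,
    prepared_initial _, prepared_initial _, prepared_initial _, Or.inr ⟨?_, ?_⟩⟩)⟩
  · norm_num [initial]
  · simp [initial]
  · simp [initial]

theorem Reach.return_twelve (hs : s.Reach 0) (h : s.Bounded) (hp : 5/2 ≤ |s.pos|) :
    s.Return 12 :=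
  (hs.return h).mono (by linarith [le_tripCost hp])

theorem Lost.next (hs : s.Lost) (h : s.Bounded) (ha : s.Allows a) :
    (s.next conv start a).Lost := by
  rcases hs with h1 | ⟨h0, h1⟩
  · exact Or.inl (h1.next h ha)
  have h2 := h1.next (conv := conv) (start := start) h ha
  rcases lt_or_eq_of_le (next_pos_nonpos (conv := conv) (start := start) h0 ha) with h3 | h3
  · exact Or.inr ⟨h3, h2⟩
  · exact Or.inl (h2.reach (h.next ha) h3)

theorem Early.partC_next (hs : s.Early) (ha : s.Allows a)
    (hu : a = .unpack → s.hand = some (-1) → s.pos ≤ 0)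
    (hp : 0 ≤ (s.next conv start a).pos) : (s.next conv start a).partC = none := by
  cases a with
  | walk y =>
    have hy : 0 ≤ y := hp
    rcases eq_or_lt_of_le hy with h0 | h0
    · simp [ExpeditionState.next, ← h0]
    · have : s.partC = none := hs.partC (by rcases ha.2.2 with h1 | h1 <;> linarith [h1.1, h1.2.1])
      simp [ExpeditionState.next, this]
  | take o =>
    rw [(next_pos_of_ne_walk (by simp)).1] at hp
    have := hs.partC hp
    by_cases h0 : s.place = 0 <;> simpa [ExpeditionState.next, h0]
  | drop =>
    rw [(next_pos_of_ne_walk (by simp)).1] at hp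
    have := hs.partC hp
    rcases hh : s.hand with _ | o <;> simpa [ExpeditionState.next, hh]
  | unpack =>
    rw [(next_pos_of_ne_walk (by simp)).1] at hp
    obtain ⟨o, ho⟩ := Option.ne_none_iff_exists'.1 ha.2
    have h1 : o * SignType.sign s.pos ≠ -1 := by
      rcases eq_or_lt_of_le hp with h0 | h0
      · simp [← h0]
      · rw [sign_pos h0, mul_one]
        rintro rfl
        linarith [hu rfl ho]
    simp [ExpeditionState.next, ho, hs.partC hp, h1]

/-- Far boxes are dropped at distance at most `5/2` on their own side, hence lie at least half way
round. Anyone who carries one on the near side has been at least half way out and owes the cost 12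
on returning. -/
theorem Early.far_next (hs : s.Early) (h : s.Bounded) (hr : s.Reach 0) (ha : s.Allows a) :
    (s.next conv start a).Return 12 ∨
      (∀ p, (-1, p) ∈ (s.next conv start a).ground → p ≠ 0 → 5/2 ≤ ahead p) ∧
      ((s.next conv start a).hand = some (-1) → 0 < (s.next conv start a).pos →
        5/2 ≤ (s.next conv start a).pos) := by
  by_cases hR : s.Return 12
  · exact Or.inl (hR.next h ha)
  have hlt := abs_lt.1 (h.abs_pos_lt ha)
  obtain ⟨hg, hh⟩ := hs.far.resolve_left hR
  have hpos : s.hand = some (-1) → s.pos ≤ 0 := fun h1 => by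
    by_contra! h2
    exact hR (hr.return_twelve h ((hh h1 h2).trans (le_abs_self _)))
  right
  cases a with
  | walk y =>
    refine ⟨hg, fun h1 h2 => ?_⟩
    have hy : 0 < y := h2
    have hx : 0 ≤ s.pos := by rcases ha.2.2 with h1 | h1 <;> linarith [h1.1, h1.2.1]
    rcases eq_or_lt_of_le hx with h0 | h0
    · have h3 : s.handAfter y = some (-1) := h1
      rw [handAfter_of_eq h0.symm] at h3
      obtain ⟨-, -, ho⟩ := Option.map_eq_some_iff.1 h3
      simp [sign_pos hy] at ho
    · have h3 : s.handAfter y = some (-1) := h1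
      rw [handAfter_of_ne h0.ne'] at h3
      linarith [hpos h3]
  | take o =>
    by_cases h0 : s.place = 0
    · simpa [ExpeditionState.next, h0] using hg
    · have hg' := ha.2.2.resolve_left h0
      simp only [ExpeditionState.next, h0, if_false, Option.some.injEq]
      refine ⟨fun p hp => hg p (Multiset.mem_of_mem_erase hp), ?_⟩
      rintro rfl hp
      have := hg _ hg' h0
      rwa [place, ahead_coe hp.le hlt.2] at this
  | drop =>
    obtain ⟨o, ho⟩ := Option.ne_none_iff_exists'.1 ha.2
    simp only [ExpeditionState.next, ho, reduceCtorEq, false_imp_iff, and_true]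
    intro p hp hp0
    rcases Multiset.mem_cons.1 hp with hp | hp
    · obtain ⟨rfl, rfl⟩ := Prod.mk.inj hp
      have h1 : s.pos < 0 :=
        lt_of_le_of_ne (hpos ho) fun h0 => hp0 ((h.place_eq_zero ha).2 h0)
      rw [place, ahead_coe_neg h.le_pos h1]
      linarith [hs.le_pos]
    · exact hg p hp hp0
  | unpack =>
    obtain ⟨o, ho⟩ := Option.ne_none_iff_exists'.1 ha.2
    simpa [ExpeditionState.next, ho] using hg

theorem Invariant.next (hs : s.Invariant) (ha : s.Allows a) :
    (s.next conv start a).Invariant := by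
  obtain ⟨h, hr, hs⟩ := hs
  have hn := h.next (conv := conv) (start := start) ha
  have hr' := hr.next (conv := conv) (start := start) h ha
  refine ⟨hn, hr', ?_⟩
  rcases hs with hs | hs | hs
  · exact Or.inl (hs.next h ha)
  · by_cases h1 : -(5/2) ≤ (s.next conv start a).pos
    · right
      by_cases hu : a = .unpack → s.hand = some (-1) → s.pos ≤ 0
      · exact Or.inl ⟨h1, hs.partC_next ha hu, hs.h16.next h ha hs.le_pos h1 hu,
          hs.h14.next h ha hs.le_pos h1 hu, hs.h6.next h ha hs.le_pos h1 hu,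
          hs.far_next h hr ha⟩
      · push Not at hu
        obtain ⟨rfl, ho, hx⟩ := hu
        refine Or.inr (hs.h16.late hs.h14 hs.h6 h ho hx (abs_lt.1 (h.abs_pos_lt ha)).2
          (hs.partC hx.le) ?_)
        rcases hs.far with h2 | h2
        · exact h2.next h ha
        · exact (hr.return_twelve h ((h2.2 ho hx).trans (le_abs_self _))).next h ha
    -- Past half way on the far side, where the far laws end, the expedition is given up as lost: it
    -- must return to base to finish at `5`, at a cost of 12.
    · push Not at h1
      have h0 : (s.next conv start a).pos < 0 := by linarith
      exact Or.inl (Or.inr ⟨h0, hr'.return_twelve hn (by rw [abs_of_neg h0]; linarith)⟩)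
  · rcases lt_or_eq_of_le (next_pos_nonneg (conv := conv) (start := start) hs.pos_pos ha)
      with h0 | h0
    · exact Or.inr (Or.inr (hs.next h ha h0))
    -- Back at the base after part C had begun: `Return 12` becomes `Reach 12`, and the case is
    -- `Lost`.
    · exact Or.inl (Or.inl ((hs.return_twelve.next h ha).reach hn h0.symm))

/-- A lost expedition needs 12 + 12 days. One that never unsealed a far box on the way out has
potential at least `70 - 303/8` at the end, far above both bounds. -/
theorem Invariant.le (hs : s.Invariant) (h5 : s.pos = 5) :
    361/16 ≤ s.time ∧ 185/8 ≤ s.cole := by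
  obtain ⟨h, -, hs⟩ := hs
  have hc := h.time_le
  rcases hs with (hs | hs) | hs | hs
  · have := hs.le_time (by rw [h5]; norm_num) h
    constructor <;> linarith
  · linarith [hs.1]
  · have h1 := hs.h14.slack_nonneg
    have h2 : 0 ≤ stock scheme14.price s := stock_nonneg scheme14.price_nonneg
    have h3 : scheme14.out 5 s.opened = 13 * s.opened + 14 * 5 - 303/8 :=
      out14_five (by norm_num) h.opened_nonneg h.opened_le
    rw [slack, h5, potential_of_nonneg _ _ _ (by norm_num), h3] at h1
    have := h.opened_nonneg
    constructor <;> linarith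
  · exact hs.le h h5

end ExpeditionState

/-! ### Reflection -/

/-- The same action in the opposite direction. -/
noncomputable def ExpeditionAction.mirror : ExpeditionAction → ExpeditionAction
  | .walk y => .walk (-y)
  | .take o => .take (-o)
  | .drop => .drop
  | .unpack => .unpack

namespace ExpeditionState

variable {conv : Convention} {start : ℝ} {s : ExpeditionState} {a : ExpeditionAction}

/-- The reflected place of a box. -/
noncomputable def mirrorBox (b : SignType × AddCircle (5 : ℝ)) : SignType × AddCircle (5 : ℝ) :=
  (-b.1, -b.2)

theorem mirrorBox_injective : Function.Injective mirrorBox := fun b c h => by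
  obtain ⟨h1, h2⟩ := Prod.mk.inj h
  exact Prod.ext (neg_injective h1) (neg_injective h2)

/-- The reflected state. -/
noncomputable def mirror (s : ExpeditionState) : ExpeditionState where
  pos := -s.pos
  opened := s.opened
  hand := s.hand.map Neg.neg
  ground := s.ground.map mirrorBox
  visited := Neg.neg ⁻¹' s.visited
  time := s.time
  partC := s.partC

theorem mirror_place : s.mirror.place = -s.place := AddCircle.coe_neg ..

theorem mirror_place_eq_zero : s.mirror.place = 0 ↔ s.place = 0 := by
  rw [mirror_place, neg_eq_zero]

theorem mirror_initial : initial.mirror = initial := by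
  simp only [mirror, initial, neg_zero, Option.map_none, Multiset.map_zero]
  congr 1
  ext p
  simp

theorem mirror_completed : s.mirror.Completed ↔ s.Completed := by
  rw [Completed, Completed, mirror_place_eq_zero]
  refine and_congr Iff.rfl ?_
  simp only [mirror, Set.eq_univ_iff_forall, Set.mem_preimage]
  exact ⟨fun h p => by simpa using h (-p), fun h p => h _⟩

theorem Allows.mirror (h : s.Allows a) : s.mirror.Allows a.mirror := by
  refine ⟨fun h1 => h.1 (mirror_completed.1 h1), ?_⟩
  obtain ⟨-, h⟩ := h
  cases a with
  | walk y =>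
    obtain ⟨h1, h2⟩ := h
    simp only [ExpeditionAction.mirror, ExpeditionState.mirror]
    refine ⟨?_, ?_⟩
    · rwa [← abs_neg, show -(-y - -s.pos) = y - s.pos by ring]
    · rcases h2 with ⟨h2, h3, h4⟩ | ⟨h2, h3, h4⟩
      · right
        refine ⟨?_, ?_, ?_⟩ <;> linarith
      · left
        refine ⟨?_, ?_, ?_⟩ <;> linarith
  | take o =>
    obtain ⟨h1, h2⟩ := h
    simp only [ExpeditionAction.mirror]
    rw [mirror_place_eq_zero, mirror_place]
    refine ⟨by simp [ExpeditionState.mirror, h1], h2.imp_right fun h3 => ?_⟩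
    exact Multiset.mem_map_of_mem mirrorBox h3
  | drop => simpa [ExpeditionAction.mirror, ExpeditionState.mirror] using h
  | unpack => simpa [ExpeditionAction.mirror, ExpeditionState.mirror] using h

theorem image_uIcc_neg (x y : ℝ) :
    (fun x : ℝ => (x : AddCircle (5 : ℝ))) '' Set.uIcc (-x) (-y) =
      Neg.neg ⁻¹' ((fun x : ℝ => (x : AddCircle (5 : ℝ))) '' Set.uIcc x y) := by
  ext p
  constructor
  · rintro ⟨t, ht, rfl⟩
    refine ⟨-t, ?_, AddCircle.coe_neg ..⟩
    rw [Set.mem_uIcc] at ht ⊢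
    rcases ht with ht | ht
    · right
      constructor <;> linarith
    · left
      constructor <;> linarith
  · rintro ⟨t, ht, hp⟩
    refine ⟨-t, ?_, ?_⟩
    · rw [Set.mem_uIcc] at ht ⊢
      rcases ht with ht | ht
      · right
        constructor <;> linarith
      · left
        constructor <;> linarith
    · dsimp only at hp ⊢
      rw [AddCircle.coe_neg, hp, neg_neg]

theorem next_mirror : s.mirror.next conv start a.mirror = (s.next conv start a).mirror := by
  cases a with
  | walk y =>
    have h1 : |(-y) - (-s.pos)| = |y - s.pos| := by
      rw [← abs_neg]
      congr 1
      ring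
    have h2 := image_uIcc_neg s.pos y
    simp only [next, ExpeditionAction.mirror, mirror, neg_eq_zero, h1, h2, Set.preimage_union]
    congr 1
    split_ifs
    · simp only [Option.map_map]
      congr 1
      funext o
      simp [Left.sign_neg]
    · rfl
  | take o =>
    by_cases h0 : s.place = 0
    · have h1 := mirror_place_eq_zero.2 h0
      simp only [next, ExpeditionAction.mirror, h0, h1, if_true]
      simp [mirror]
    · have h1 : ¬s.mirror.place = 0 := fun h => h0 (mirror_place_eq_zero.1 h)
      simp only [next, ExpeditionAction.mirror, h0, h1, if_false]
      simp only [mirror_place]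
      simp only [mirror, Option.map_some, ExpeditionState.mk.injEq, true_and, and_true]
      exact (Multiset.map_erase mirrorBox mirrorBox_injective (o, s.place) s.ground).symm
  | drop =>
    rcases ho : s.hand with _ | o
    · simp [next, ExpeditionAction.mirror, mirror, ho]
    · simp only [next, ExpeditionAction.mirror, ho, mirror_place]
      simp [mirror, ho, mirrorBox]
  | unpack =>
    rcases ho : s.hand with _ | o
    · simp [next, ExpeditionAction.mirror, mirror, ho]
    · simp [next, ExpeditionAction.mirror, mirror, ho, Left.sign_neg]

theorem run_mirror (plan : List ExpeditionAction) : ∀ s : ExpeditionState,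
    s.mirror.run conv start (plan.map ExpeditionAction.mirror) =
      (s.run conv start plan).mirror := by
  induction plan with
  | nil => exact fun _ => rfl
  | cons a plan ih =>
    intro s
    rw [List.map_cons, run_cons, run_cons, next_mirror, ih]

theorem Feasible.mirror : ∀ (plan : List ExpeditionAction) (s : ExpeditionState),
    s.Feasible conv start plan →
      s.mirror.Feasible conv start (plan.map ExpeditionAction.mirror)
  | [], _, _ => trivial
  | a :: plan, s, h => ⟨h.1.mirror, by
      rw [next_mirror]
      exact Feasible.mirror plan _ h.2⟩

end ExpeditionState

/-! ### The lower bounds -/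

section LowerBound

open ExpeditionState

variable {conv : Convention} {start : ℝ} {plan : List ExpeditionAction}

theorem invariant_outcome (h : ExpeditionState.initial.Feasible conv start plan) :
    (outcome conv start plan).Invariant :=
  run_induction (fun _ _ hs ha => hs.next ha) plan _ invariant_initial h

theorem covers_outcome (h : ExpeditionState.initial.Feasible conv start plan) :
    (outcome conv start plan).Bounded ∧ (outcome conv start plan).Covers :=
  run_induction (I := fun s => s.Bounded ∧ s.Covers)
    (fun _ _ hs ha => ⟨hs.1.next ha, hs.2.next hs.1 ha⟩) plan _
    ⟨bounded_initial, covers_initial⟩ h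

/-- The final coordinate is `5`, `-5` or `0`. The second case is reflected into the first; in the
third both sides were visited by excursions and `Covers` gives 24 days. -/
theorem le_outcome (h : Solves conv start plan) :
    361/16 ≤ (outcome conv start plan).time ∧ 185/8 ≤ (outcome conv start plan).cole := by
  obtain ⟨hf, hp, hv⟩ := h
  obtain ⟨hb, hc⟩ := covers_outcome hf
  rcases eq_or_lt_of_le hb.pos_le with h5 | h5
  · exact (invariant_outcome hf).le h5
  rcases eq_or_lt_of_le hb.le_pos with h5' | h5'
  · have hm : outcome conv start (plan.map ExpeditionAction.mirror) =
        (outcome conv start plan).mirror := by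
      rw [outcome, ← mirror_initial, run_mirror, outcome]
    have hf' : ExpeditionState.initial.Feasible conv start (plan.map ExpeditionAction.mirror) := by
      rw [← mirror_initial]
      exact hf.mirror
    have h1 := (invariant_outcome hf').le (by
      rw [hm, ExpeditionState.mirror, ← h5']
      norm_num)
    rwa [hm] at h1
  · have h0 : (outcome conv start plan).pos = 0 := (coe_eq_zero_iff h5' h5).1 hp
    have h1 := hc.le_time hb hv h0
    have h2 := hb.time_le
    constructor <;> linarith

end LowerBound

/-! ### Expeditions on a lattice -/

/-- Actions at the multiples of `1/64`. -/
inductive LatticeAction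
  | walk (n : ℤ)
  | take (o : SignType)
  | drop
  | unpack

/-- The action that is described by a lattice action. -/
noncomputable def LatticeAction.toAction : LatticeAction → ExpeditionAction
  | .walk n => .walk (n / 64)
  | .take o => .take o
  | .drop => .drop
  | .unpack => .unpack

/-- The state of an expedition at the multiples of `1/64`. All visited places lie between `lo` and
`hi`. -/
structure LatticeState where
  pos : ℤ
  opened : ℤ
  hand : Option SignType
  ground : List (SignType × ℤ)
  lo : ℤ
  hi : ℤ
  time : ℤ
  partC : Option (ℤ × ℕ)

namespace LatticeState

/-- The place of a box on the ground. -/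
noncomputable def toBox (b : SignType × ℤ) : SignType × AddCircle (5 : ℝ) :=
  (b.1, ((b.2 / 64 : ℝ) : AddCircle (5 : ℝ)))

/-- The lattice state `c` describes the state `s`. -/
structure Describes (c : LatticeState) (s : ExpeditionState) : Prop where
  pos : s.pos = c.pos / 64
  opened : s.opened = c.opened / 64
  hand : s.hand = c.hand
  ground : s.ground = (c.ground : Multiset (SignType × ℤ)).map toBox
  lo_le : c.lo ≤ 0
  le_hi : 0 ≤ c.hi
  visited : s.visited ⊆
    (fun x : ℝ => (x : AddCircle (5 : ℝ))) '' Set.Icc ((c.lo : ℝ) / 64) ((c.hi : ℝ) / 64)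
  time : s.time = c.time / 64
  partC : s.partC = c.partC.map fun t => ((t.1 : ℝ) / 64, t.2)
  lo_le_pos : c.lo ≤ c.pos
  pos_le_hi : c.pos ≤ c.hi

/-- What can be eaten from a box that is unsealed at the time `t`, if the start is at `7/8`. -/
def portion : Convention → ℤ → ℤ
  | .discard, _ => 64
  | .ants, t => 64 - (56 + t) % 64

/-- The effect of an action, if it is allowed. -/
noncomputable def step (conv : Convention) (c : LatticeState) : LatticeAction → Option LatticeState
  | .walk n =>
    if |n - c.pos| ≤ c.opened ∧ ((0 ≤ c.pos ∧ 0 ≤ n ∧ n ≤ 320) ∨ (c.pos ≤ 0 ∧ n ≤ 0 ∧ -320 ≤ n)) ∧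
        (c.pos % 320 ≠ 0 ∨ c.hi - c.lo < 320) then
      some { c with
        pos := n
        opened := c.opened - |n - c.pos|
        hand := if c.pos = 0 then c.hand.map fun _ => SignType.sign n else c.hand
        lo := min c.lo n
        hi := max c.hi n
        time := c.time + |n - c.pos|
        partC := if n = 0 then none else c.partC }
    else none
  | .take o =>
    if c.hand = none ∧ (c.pos % 320 ≠ 0 ∨ c.hi - c.lo < 320) then
      if c.pos % 320 = 0 then some { c with hand := some 0 }
      else if (o, c.pos % 320) ∈ c.ground then
        some { c with
          hand := some o,
          ground := @List.erase _ instBEqOfDecidableEq c.ground (o, c.pos % 320) }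
      else none
    else none
  | .drop =>
    if c.pos % 320 ≠ 0 ∨ c.hi - c.lo < 320 then
      match c.hand with
      | none => none
      | some o => some { c with hand := none, ground := (o, c.pos % 320) :: c.ground }
    else none
  | .unpack =>
    if c.pos % 320 ≠ 0 ∨ c.hi - c.lo < 320 then
      match c.hand with
      | none => none
      | some o =>
        some { c with
          hand := none
          opened := portion conv c.time
          partC := match c.partC with
            | some (t, n) => some (t, n + 1)
            | none => if o * SignType.sign c.pos = -1 then some (c.time, 1) else none }
    else none

/-- The effect of a plan, if it is feasible. -/
noncomputable def run (conv : Convention) : LatticeState → List LatticeAction → Option LatticeState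
  | c, [] => some c
  | c, a :: plan => (c.step conv a).bind fun c' => run conv c' plan

/-- At the base, with nothing yet done. -/
def initial : LatticeState := ⟨0, 0, none, [], 0, 0, 0, none⟩

theorem describes_initial : initial.Describes ExpeditionState.initial := by
  constructor <;> simp [initial, ExpeditionState.initial]

/-- The 56 in the integer formula is the starting moment `7/8` in units of `1/64`. -/
theorem portion_eq (conv : Convention) (t : ℤ) :
    conv.portion (7/8 + t / 64) = (portion conv t : ℝ) / 64 := by
  cases conv
  · norm_num [Convention.portion, portion]
  · simp only [Convention.portion, portion]
    have h : Int.fract ((7/8 : ℝ) + t / 64) = (((56 + t) % 64 : ℤ) : ℝ) / 64 := by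
      rw [Int.fract_eq_iff]
      have h0 := Int.emod_nonneg (56 + t) (by norm_num : (64 : ℤ) ≠ 0)
      have h1 := Int.emod_lt_of_pos (56 + t) (by norm_num : (0 : ℤ) < 64)
      have h2 := Int.emod_add_mul_ediv (56 + t) 64
      have h0' : (0 : ℝ) ≤ ((56 + t) % 64 : ℤ) := by exact_mod_cast h0
      have h1' : (((56 + t) % 64 : ℤ) : ℝ) < 64 := by exact_mod_cast h1
      have h2' : (((56 + t) % 64 : ℤ) : ℝ) + 64 * ((56 + t) / 64 : ℤ) = 56 + t := by
        exact_mod_cast h2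
      refine ⟨by positivity, by linarith, (56 + t) / 64, ?_⟩
      linarith
    rw [h]
    push_cast
    ring

theorem coe_emod (n : ℤ) :
    (((n % 320 : ℤ) / 64 : ℝ) : AddCircle (5 : ℝ)) = ((n / 64 : ℝ) : AddCircle (5 : ℝ)) := by
  have h2 : (((n % 320 : ℤ) : ℝ)) + 320 * ((n / 320 : ℤ) : ℝ) = n := by
    exact_mod_cast Int.emod_add_mul_ediv n 320
  have h : (n / 64 : ℝ) = (n % 320 : ℤ) / 64 + (n / 320 : ℤ) • (5 : ℝ) := by
    rw [zsmul_eq_mul]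
    linarith
  rw [h, AddCircle.coe_add, AddCircle.coe_zsmul, coe_five, smul_zero, add_zero]

theorem coe_eq_zero (n : ℤ) : ((n / 64 : ℝ) : AddCircle (5 : ℝ)) = 0 ↔ n % 320 = 0 := by
  have h0 := Int.emod_nonneg n (by norm_num : (320 : ℤ) ≠ 0)
  have h1 := Int.emod_lt_of_pos n (by norm_num : (0 : ℤ) < 320)
  have h0' : (0 : ℝ) ≤ (n % 320 : ℤ) := by exact_mod_cast h0
  have h1' : ((n % 320 : ℤ) : ℝ) < 320 := by exact_mod_cast h1
  rw [← coe_emod, coe_eq_zero_iff (by linarith) (by linarith), div_eq_zero_iff]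
  norm_num

theorem sign_div (n : ℤ) : SignType.sign ((n : ℝ) / 64) = SignType.sign n := by
  rcases lt_trichotomy n 0 with h | h | h
  · have : (n : ℝ) < 0 := by exact_mod_cast h
    rw [sign_neg h, sign_neg (by linarith)]
  · simp [h]
  · have : (0 : ℝ) < n := by exact_mod_cast h
    rw [sign_pos h, sign_pos (by linarith)]

variable {conv : Convention} {c c' : LatticeState} {s : ExpeditionState} {a : LatticeAction}

theorem Describes.place (h : c.Describes s) :
    s.place = (((c.pos % 320 : ℤ) / 64 : ℝ) : AddCircle (5 : ℝ)) := by
  rw [ExpeditionState.place, h.pos, coe_emod]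

theorem Describes.place_eq_zero (h : c.Describes s) : s.place = 0 ↔ c.pos % 320 = 0 := by
  rw [ExpeditionState.place, h.pos, coe_eq_zero]

/-- Instead of the visited set only its hull is tracked: a hull shorter than the circuit, 320 units,
leaves some point unvisited. -/
theorem Describes.not_completed (h : c.Describes s)
    (hc : c.pos % 320 ≠ 0 ∨ c.hi - c.lo < 320) : ¬s.Completed := by
  rintro ⟨h1, h2⟩
  refine hc.elim (fun h3 => h3 (h.place_eq_zero.1 h1)) fun h3 => ?_
  have h4 : (c.hi : ℝ) - c.lo < 320 := by exact_mod_cast h3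
  have h5 : (c.lo : ℝ) ≤ 0 := by exact_mod_cast h.lo_le
  have h6 : (0 : ℝ) ≤ c.hi := by exact_mod_cast h.le_hi
  have h7 := h.visited
  rw [h2, show (c.lo : ℝ) / 64 = -(-c.lo / 64) by ring] at h7
  have := ExpeditionState.five_le_of_univ_subset (by positivity) (by linarith) h7
  linarith

theorem Describes.step (h : c.Describes s) (hs : c.step conv a = some c') :
    s.Allows a.toAction ∧ c'.Describes (s.next conv (7/8) a.toAction) := by
  cases a with
  | walk n =>
    simp only [LatticeState.step] at hs
    rw [Option.ite_none_right_eq_some] at hs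
    obtain ⟨⟨h1, h2, h3⟩, hs⟩ := hs
    cases hs
    have e1 : |(n : ℝ) / 64 - s.pos| = (|n - c.pos| : ℤ) / 64 := by
      rw [h.pos, ← sub_div, abs_div]
      push_cast
      norm_num
    have e2 : s.pos = 0 ↔ c.pos = 0 := by rw [h.pos]; simp
    refine ⟨⟨h.not_completed h3, ?_, ?_⟩, ?_⟩
    · rw [e1, h.opened]
      gcongr
    · rw [h.pos]
      rcases h2 with ⟨h2, h4, h5⟩ | ⟨h2, h4, h5⟩
      · left
        have h2' : (0 : ℝ) ≤ c.pos := by exact_mod_cast h2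
        have h4' : (0 : ℝ) ≤ n := by exact_mod_cast h4
        have h5' : (n : ℝ) ≤ 320 := by exact_mod_cast h5
        refine ⟨?_, ?_, ?_⟩ <;> linarith
      · right
        have h2' : (c.pos : ℝ) ≤ 0 := by exact_mod_cast h2
        have h4' : (n : ℝ) ≤ 0 := by exact_mod_cast h4
        have h5' : (-320 : ℝ) ≤ n := by exact_mod_cast h5
        refine ⟨?_, ?_, ?_⟩ <;> linarith
    · simp only [ExpeditionState.next, LatticeAction.toAction]
      constructor
      · rfl
      · simp only [e1, h.opened]
        push_cast
        ring
      · simp only [e2, h.hand, sign_div]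
      · exact h.ground
      · exact (min_le_left _ _).trans h.lo_le
      · exact h.le_hi.trans (le_max_left _ _)
      · have m1 : ((min c.lo n : ℤ) : ℝ) ≤ c.lo := by exact_mod_cast min_le_left _ _
        have m2 : ((min c.lo n : ℤ) : ℝ) ≤ n := by exact_mod_cast min_le_right _ _
        have m3 : (c.hi : ℝ) ≤ (max c.hi n : ℤ) := by exact_mod_cast le_max_left _ _
        have m4 : (n : ℝ) ≤ (max c.hi n : ℤ) := by exact_mod_cast le_max_right _ _
        refine Set.union_subset (h.visited.trans (Set.image_mono (Set.Icc_subset_Icc ?_ ?_)))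
          (Set.image_mono ?_)
        · gcongr
        · gcongr
        · have m6 : (c.lo : ℝ) ≤ c.pos := by exact_mod_cast h.lo_le_pos
          have m7 : (c.pos : ℝ) ≤ c.hi := by exact_mod_cast h.pos_le_hi
          rw [h.pos]
          refine Set.uIcc_subset_Icc ⟨?_, ?_⟩ ⟨?_, ?_⟩ <;> dsimp only <;> linarith
      · simp only [e1, h.time]
        push_cast
        ring
      · simp only [h.partC, div_eq_zero_iff, Int.cast_eq_zero, OfNat.ofNat_ne_zero, or_false]
        split_ifs <;> rfl
      · exact min_le_right _ _
      · exact le_max_right _ _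
  | take o =>
    simp only [LatticeState.step] at hs
    split_ifs at hs with h1 h2 h3
    · cases hs
      have h0 := h.place_eq_zero.2 h2
      refine ⟨⟨h.not_completed h1.2, h.hand.trans h1.1, Or.inl h0⟩, ?_⟩
      simp only [ExpeditionState.next, LatticeAction.toAction, h0, if_true]
      exact ⟨h.1, h.2, rfl, h.4, h.5, h.6, h.7, h.8, h.9, h.10, h.11⟩
    · cases hs
      have h0 : s.place ≠ 0 := fun h0 => h2 (h.place_eq_zero.1 h0)
      have hm : (o, c.pos % 320) ∈ (c.ground : Multiset (SignType × ℤ)) := h3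
      have hb : (o, s.place) = toBox (o, c.pos % 320) := Prod.ext rfl h.place
      refine ⟨⟨h.not_completed h1.2, h.hand.trans h1.1, Or.inr ?_⟩, ?_⟩
      · rw [hb, h.ground]
        exact Multiset.mem_map_of_mem _ hm
      · simp only [ExpeditionState.next, LatticeAction.toAction, h0, if_false]
        refine ⟨h.1, h.2, rfl, ?_, h.5, h.6, h.7, h.8, h.9, h.10, h.11⟩
        dsimp only
        rw [hb, h.ground, ← Multiset.coe_erase]
        exact (Multiset.map_erase_of_mem _ _ hm).symm
  | drop =>
    simp only [LatticeState.step] at hs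
    split_ifs at hs with h1
    rcases ho : c.hand with _ | o
    · simp [ho] at hs
    · simp only [ho, Option.some.injEq] at hs
      subst hs
      have ho' := h.hand.trans ho
      refine ⟨⟨h.not_completed h1, Option.ne_none_iff_exists'.2 ⟨o, ho'⟩⟩, ?_⟩
      simp only [ExpeditionState.next, LatticeAction.toAction, ho']
      refine ⟨h.1, h.2, rfl, ?_, h.5, h.6, h.7, h.8, h.9, h.10, h.11⟩
      dsimp only
      rw [h.ground, h.place, ← Multiset.cons_coe, Multiset.map_cons]
      rfl
  | unpack =>
    simp only [LatticeState.step] at hs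
    split_ifs at hs with h1
    rcases ho : c.hand with _ | o
    · simp [ho] at hs
    · simp only [ho, Option.some.injEq] at hs
      subst hs
      have ho' := h.hand.trans ho
      refine ⟨⟨h.not_completed h1, Option.ne_none_iff_exists'.2 ⟨o, ho'⟩⟩, ?_⟩
      simp only [ExpeditionState.next, LatticeAction.toAction, ho']
      refine ⟨h.1, ?_, rfl, h.4, h.5, h.6, h.7, h.8, ?_, h.10, h.11⟩
      · dsimp only
        rw [h.time, portion_eq]
      · dsimp only
        rw [h.partC, h.pos, sign_div, h.time]
        rcases c.partC with _ | ⟨t, n⟩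
        · simp only [Option.map_none]
          split_ifs <;> simp
        · rfl

theorem Describes.run : ∀ (plan : List LatticeAction) (c : LatticeState) (s : ExpeditionState),
    c.Describes s → c.run conv plan = some c' →
      s.Feasible conv (7/8) (plan.map LatticeAction.toAction) ∧
        c'.Describes (s.run conv (7/8) (plan.map LatticeAction.toAction))
  | [], c, s, h, hr => by
    cases hr
    exact ⟨trivial, h⟩
  | a :: plan, c, s, h, hr => by
    obtain ⟨c₁, h1, h2⟩ := Option.bind_eq_some_iff.1 hr
    obtain ⟨h3, h4⟩ := h.step h1
    obtain ⟨h5, h6⟩ := Describes.run plan c₁ _ h4 h2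
    exact ⟨⟨h3, h5⟩, h6⟩

end LatticeState

section LatticeAlgorithm

open LatticeAction

/-- Take a box and open it, then take another one. -/
def latticeLoad (o : SignType) : List LatticeAction := [take o, unpack, take o]

/-- Pick up a box of origin `o`, bring it to `n` and dump it there. -/
def latticeFetch (o : SignType) (n : ℤ) : List LatticeAction := [take o, walk n, drop]

/-- Part A in units of `1/64`. -/
def latticePartA : List LatticeAction :=
  latticeLoad 0 ++ [walk (-4), drop, walk 0] ++
  latticeLoad 0 ++ [walk (-8), drop, walk (-4)] ++ latticeFetch (-1) (-28) ++ [walk 0] ++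
  latticeLoad 0 ++ [walk (-20), drop, walk (-8)] ++ latticeFetch (-1) (-20) ++ [walk 0] ++
  latticeLoad 0 ++ [walk (-32), drop, walk 0] ++
  latticeLoad 0 ++ [walk (-32), drop, walk 0] ++
  latticeLoad 0 ++ [walk (-42), drop, walk (-20)] ++
  latticeLoad (-1) ++ [walk (-56), drop, walk (-42)] ++ latticeFetch (-1) (-44) ++ [walk (-32)] ++
  latticeLoad (-1) ++ [walk (-64), drop, walk (-44), take (-1), walk (-56)] ++
  [unpack, take (-1), walk (-92), drop, walk (-64)] ++
  [take (-1), unpack, walk 0]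

/-- Part B in units of `1/64`. -/
def latticePartB : List LatticeAction :=
  latticeLoad 0 ++ [walk 32, drop, walk 0] ++
  latticeLoad 0 ++ [walk 32, drop, walk 0] ++
  latticeLoad 0 ++ [walk 32, drop, walk 0] ++
  latticeLoad 0 ++ [walk 32, drop, walk 0] ++
  latticeLoad 0 ++ [walk 32, drop, walk 0] ++
  latticeLoad 0 ++ [walk 40, drop, walk 32] ++ latticeFetch 1 40 ++ [walk 32] ++
  latticeLoad 1 ++ [walk 64, drop, walk 32] ++
  latticeLoad 1 ++ [walk 66, drop, walk 64] ++ latticeFetch 1 66 ++ [walk 40] ++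
  latticeLoad 1 ++ [walk 85, drop, walk 66] ++
  latticeLoad 1 ++ [walk 100, drop, walk 85, take 1, walk 100] ++
  [unpack, take 1, walk 164, unpack, walk 228]

/-- Part C in units of `1/64`. -/
def latticePartC : List LatticeAction :=
  [take (-1), unpack, walk 292, take (-1), unpack, walk 320]

end LatticeAlgorithm

theorem load_eq (o : SignType) : load o = (latticeLoad o).map LatticeAction.toAction := rfl

theorem fetch_eq (o : SignType) {y : ℝ} (n : ℤ) (h : y = n / 64) :
    fetch o y = (latticeFetch o n).map LatticeAction.toAction := by
  rw [h]
  rfl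

theorem bestPartA_eq : bestPartA = latticePartA.map LatticeAction.toAction := by
  unfold bestPartA latticePartA
  simp only [List.map_append]
  repeat' with_reducible refine congrArg₂ HAppend.hAppend ?_ ?_
  all_goals first
    | exact load_eq _
    | exact fetch_eq _ _ (by norm_num)
    | (simp only [List.map_cons, List.map_nil, LatticeAction.toAction]; norm_num)

theorem bestPartB_eq : bestPartB = latticePartB.map LatticeAction.toAction := by
  unfold bestPartB latticePartB
  simp only [List.map_append]
  repeat' with_reducible refine congrArg₂ HAppend.hAppend ?_ ?_
  all_goals first
    | exact load_eq _
    | exact fetch_eq _ _ (by norm_num)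
    | (simp only [List.map_cons, List.map_nil, LatticeAction.toAction]; norm_num)

theorem bestPartC_eq : bestPartC = latticePartC.map LatticeAction.toAction := by
  simp only [bestPartC, latticePartC, List.map_cons, List.map_nil, LatticeAction.toAction]
  norm_num

theorem bestAlgorithm_eq : bestAlgorithm =
    (latticePartA ++ latticePartB ++ latticePartC).map LatticeAction.toAction := by
  rw [bestAlgorithm, bestPartA_eq, bestPartB_eq, bestPartC_eq, List.map_append, List.map_append]

/-- In units of `1/64`: 1444 is `361/16` days, and part C begins at 1352, so that 1352 + 2 · 64 =
1480 is `185/8`. -/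
theorem latticeRun_eq (conv : Convention) :
    (LatticeState.initial.run conv (latticePartA ++ latticePartB ++ latticePartC)).map
      (fun c => (c.pos, c.time, c.partC)) = some (320, 1444, some (1352, 2)) := by
  cases conv
  · decide +kernel
  · decide +kernel

theorem bestAlgorithm_outcome (conv : Convention) :
    Solves conv (7/8) bestAlgorithm ∧ (outcome conv (7/8) bestAlgorithm).pos = 5 ∧
      (outcome conv (7/8) bestAlgorithm).time = 361/16 ∧
      (outcome conv (7/8) bestAlgorithm).cole = 185/8 := by
  obtain ⟨c, hc, he⟩ := Option.map_eq_some_iff.1 (latticeRun_eq conv)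
  obtain ⟨h1, h2, h3⟩ : c.pos = 320 ∧ c.time = 1444 ∧ c.partC = some (1352, 2) := by
    simpa using he
  obtain ⟨hf, hd⟩ := LatticeState.Describes.run _ _ _ LatticeState.describes_initial hc
  rw [← bestAlgorithm_eq] at hf hd
  have hd' : c.Describes (outcome conv (7/8) bestAlgorithm) := hd
  have hp : (outcome conv (7/8) bestAlgorithm).pos = 5 := by
    rw [hd'.pos, h1]
    norm_num
  refine ⟨⟨hf, (covers_outcome hf).1.completed (by rw [hp]; norm_num)⟩, hp, ?_, ?_⟩
  · rw [hd'.time, h2]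
    norm_num
  · rw [ExpeditionState.cole, hd'.partC, h3]
    norm_num

theorem mainTheorem1 (conv : Convention) :
    (Solves conv (7/8) bestAlgorithm ∧
      (outcome conv (7/8) bestAlgorithm).pos = 5 ∧
      (outcome conv (7/8) bestAlgorithm).time = 361/16 ∧
      (outcome conv (7/8) bestAlgorithm).cole = 185/8) ∧
    IsLeast {t : ℝ | ∃ start ∈ Set.Ico (0 : ℝ) 1, ∃ plan : List ExpeditionAction,
      Solves conv start plan ∧ (outcome conv start plan).time = t} (361/16) ∧
    IsLeast {t : ℝ | ∃ start ∈ Set.Ico (0 : ℝ) 1, ∃ plan : List ExpeditionAction,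
      Solves conv start plan ∧ (outcome conv start plan).cole = t} (185/8) := by
  have h := bestAlgorithm_outcome conv
  refine ⟨h, ⟨⟨7/8, by norm_num, bestAlgorithm, h.1, h.2.2.1⟩, ?_⟩,
    ⟨⟨7/8, by norm_num, bestAlgorithm, h.1, h.2.2.2⟩, ?_⟩⟩
  · rintro t ⟨start, -, plan, hs, rfl⟩
    exact (le_outcome hs).1
  · rintro t ⟨start, -, plan, hs, rfl⟩
    exact (le_outcome hs).2
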